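/- Let $k$ be an arbitrary field. Let $\mathrm{Cat}_k$ be the symmetric monoidal 2-category whose objects are the (essentially small) finitely cocomplete $k$-linear categories, whose 1-morphisms are the right exact $k$-linear functors (those preserving finite colimits), and whose 2-morphisms are the natural transformations. Its tensor product is the Deligne–Kelly tensor product $\boxtimes$: the functor $C\times D\to C\boxtimes D$ is $k$-linear and right exact in each variable and is universal with this property. The tensor unit is the category $\mathrm{Vect}$ of finite-dimensional $k$-vector spaces. A dual of $C$ is an object $C^\vee$ with 1-morphisms $\langle\ |\ \rangle\colon C^\vee\boxtimes C\to\mathrm{Vect}$ (the duality pairing) and $\mathrm{Vect}\to C\boxtimes C^\vee$ (the copairing) satisfying the two zigzag identities up to isomorphism. An object $C$ is 2-dualizable if it has a dual whose pairing and copairing each have both a left and a right adjoint in $\mathrm{Cat}_k$. **Theorem.** Let $C$ be a 2-dualizable object of $\mathrm{Cat}_k$. Then $C$ is finite semisimple abelian; that is, $C$ is abelian, its Hom spaces are finite-dimensional, its objects have finite length, it has enough projectives and only finitely many simple objects up to isomorphism, and every object is a direct sum of simple objects. Moreover, for every dual $C^\vee$ of $C$ there is an equivalence of $k$-linear categories $C^{\mathrm{op}}\simeq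 C^\vee$, $x^{\mathrm{op}}\mapsto\xi_x$, under which the duality pairing is identified with $\mathrm{Hom}$: there are isomorphisms of vector spaces $$\langle \xi_x\,|\,y\rangle\cong\mathrm{Hom}_C(x,y),\qquad x,y\in C,$$ natural in both variables. -/

import Mathlib

open CategoryTheory Limits

universe u

/-! ### The 2-category of finitely cocomplete linear categories -/

/-- An object of `Cat_k`: an (essentially small) finitely cocomplete `k`-linear category. -/
structure RexCat (k : Type u) [Field k] where
  carrier : Type (u + 1)
  [category : Category.{u} carrier]
  [preadditive : Preadditive carrier]
  [linear : Linear k carrier]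
  [hasFiniteColimits : HasFiniteColimits carrier]
  [essentiallySmall : EssentiallySmall.{u} carrier]

namespace RexCat

attribute [instance] category preadditive linear hasFiniteColimits essentiallySmall

/-- A functor between `k`-linear categories is a 1-morphism of `Cat_k` if it is `k`-linear and
right exact, i.e. preserves finite colimits. -/
structure IsRex (k : Type u) [Field k] {C D : Type (u + 1)} [Category.{u} C] [Category.{u} D]
    [Preadditive C] [Preadditive D] [Linear k C] [Linear k D] (F : C ⥤ D) : Prop where
  additive : F.Additive
  linear : F.Linear k
  preservesFiniteColimits : PreservesFiniteColimits F

theorem IsRex.id (k : Type u) [Field k] (C : Type (u + 1)) [Category.{u} C] [Preadditive C]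
    [Linear k C] : IsRex k (𝟭 C) :=
  ⟨inferInstance, inferInstance, inferInstance⟩

theorem IsRex.comp {k : Type u} [Field k] {C D E : Type (u + 1)} [Category.{u} C]
    [Category.{u} D] [Category.{u} E] [Preadditive C] [Preadditive D] [Preadditive E]
    [Linear k C] [Linear k D] [Linear k E] {F : C ⥤ D} {G : D ⥤ E}
    (hF : IsRex k F) (hG : IsRex k G) : IsRex k (F ⋙ G) := by
  obtain ⟨_, _, _⟩ := hF
  obtain ⟨_, _, _⟩ := hG
  exact ⟨inferInstance, inferInstance, comp_preservesFiniteColimits F G⟩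

/-- The category of right exact `k`-linear functors `C ⥤ D` and all natural transformations. -/
abbrev Rex {k : Type u} [Field k] (C D : RexCat.{u} k) : Type (u + 1) :=
  ObjectProperty.FullSubcategory (fun F : C.carrier ⥤ D.carrier => IsRex k F)

/-- `Cat_k` as a 2-category: 1-morphisms are right exact `k`-linear functors, 2-morphisms are
natural transformations. -/
instance bicategory (k : Type u) [Field k] : Bicategory (RexCat.{u} k) where
  Hom C D := Rex C D
  id C := ⟨𝟭 C.carrier, IsRex.id k C.carrier⟩
  comp F G := ⟨F.obj ⋙ G.obj, F.property.comp G.property⟩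
  homCategory C D := inferInstanceAs (Category (Rex C D))
  whiskerLeft F _ _ η := ObjectProperty.homMk (Functor.whiskerLeft F.obj η.hom)
  whiskerRight η H := ObjectProperty.homMk (Functor.whiskerRight η.hom H.obj)
  associator F G H := ObjectProperty.isoMk _ (Functor.associator F.obj G.obj H.obj)
  leftUnitor F := ObjectProperty.isoMk _ F.obj.leftUnitor
  rightUnitor F := ObjectProperty.isoMk _ F.obj.rightUnitor

/-- The functor underlying a 1-morphism of `Cat_k`. -/
def functor {k : Type u} [Field k] {C D : RexCat.{u} k} (F : C ⟶ D) : C.carrier ⥤ D.carrier :=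
  ObjectProperty.FullSubcategory.obj F

theorem isRex {k : Type u} [Field k] {C D : RexCat.{u} k} (F : C ⟶ D) : IsRex k (functor F) :=
  ObjectProperty.FullSubcategory.property F

/-- The 1-morphism of `Cat_k` given by a right exact `k`-linear functor. -/
def ofFunctor {k : Type u} [Field k] {C D : RexCat.{u} k} (F : C.carrier ⥤ D.carrier)
    (hF : IsRex k F) : C ⟶ D :=
  (⟨F, hF⟩ : Rex C D)

/-- `Vect`, the category of finite-dimensional vector spaces: the tensor unit of `Cat_k`. -/
def vect (k : Type u) [Field k] : RexCat.{u} k where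
  carrier := FGModuleCat.{u} k

/-- The one-dimensional vector space `k` as an object of `Vect`. -/
def vectUnit (k : Type u) [Field k] : (vect k).carrier := FGModuleCat.of k k

/-- The inclusion of `Vect` in the category of all vector spaces. -/
def vectInclusion (k : Type u) [Field k] : (vect k).carrier ⥤ ModuleCat.{u} k :=
  forget₂ (FGModuleCat.{u} k) (ModuleCat.{u} k)

/-! ### The Deligne–Kelly tensor product -/

/-- A functor of two variables which is `k`-linear and right exact in each variable. -/
structure IsBirex {k : Type u} [Field k] {C D E : RexCat.{u} k}
    (T : C.carrier ⥤ D.carrier ⥤ E.carrier) : Prop where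
  left (d : D.carrier) : IsRex k (T.flip.obj d)
  right (c : C.carrier) : IsRex k (T.obj c)

/-- The category of functors `C × D → E` that are `k`-linear and right exact in each variable. -/
abbrev Birex {k : Type u} [Field k] (C D E : RexCat.{u} k) : Type (u + 1) :=
  ObjectProperty.FullSubcategory
    (fun T : C.carrier ⥤ D.carrier ⥤ E.carrier => IsBirex T)

/-- `(c, d) ↦ F (T (c, d))`. -/
abbrev postcomp {k : Type u} [Field k] {C D E X : RexCat.{u} k}
    (T : C.carrier ⥤ D.carrier ⥤ E.carrier) (F : E.carrier ⥤ X.carrier) :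
    C.carrier ⥤ D.carrier ⥤ X.carrier :=
  T ⋙ (Functor.whiskeringRight _ _ _).obj F

theorem IsBirex.postcomp {k : Type u} [Field k] {C D E X : RexCat.{u} k}
    {T : C.carrier ⥤ D.carrier ⥤ E.carrier} (hT : IsBirex T) {F : E.carrier ⥤ X.carrier}
    (hF : IsRex k F) : IsBirex (RexCat.postcomp T F) :=
  ⟨fun d => (hT.left d).comp hF, fun c => (hT.right c).comp hF⟩

/-- Restriction along `T : C × D → E`: the functor `F ↦ F ∘ T` from right exact functors on `E`
to functors on `C × D` that are right exact in each variable. -/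
def restrict {k : Type u} [Field k] {C D E : RexCat.{u} k}
    (T : C.carrier ⥤ D.carrier ⥤ E.carrier) (hT : IsBirex T) (X : RexCat.{u} k) :
    Rex E X ⥤ Birex C D X where
  obj F := ⟨postcomp T F.obj, hT.postcomp F.property⟩
  map η := ObjectProperty.homMk
    (Functor.whiskerLeft T ((Functor.whiskeringRight _ _ _).map η.hom))

/-- A Deligne–Kelly tensor product of `C` and `D`: an object `C ⊠ D` of `Cat_k` with a functor
`(c, d) ↦ c ⊠ d`, `k`-linear and right exact in each variable, which is universal: for every `X`
in `Cat_k`, restriction along it is an equivalence from `Rex (C ⊠ D, X)` to the category of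
functors `C × D → X` that are `k`-linear and right exact in each variable. -/
structure Tensor {k : Type u} [Field k] (C D : RexCat.{u} k) where
  obj : RexCat.{u} k
  tmul : C.carrier ⥤ D.carrier ⥤ obj.carrier
  isBirex : IsBirex tmul
  universal (X : RexCat.{u} k) : (restrict tmul isBirex X).IsEquivalence

/-- The 1-morphism out of `C ⊠ D` induced by a functor that is right exact in each variable. -/
noncomputable def Tensor.lift {k : Type u} [Field k] {C D X : RexCat.{u} k} (P : Tensor C D)
    (T : C.carrier ⥤ D.carrier ⥤ X.carrier) (hT : IsBirex T) : P.obj ⟶ X :=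
  have := P.universal X
  (restrict P.tmul P.isBirex X).inv.obj ⟨T, hT⟩

/-- The defining property of `Tensor.lift`. -/
noncomputable def Tensor.liftIso {k : Type u} [Field k] {C D X : RexCat.{u} k} (P : Tensor C D)
    (T : C.carrier ⥤ D.carrier ⥤ X.carrier) (hT : IsBirex T) :
    postcomp P.tmul (functor (P.lift T hT)) ≅ T :=
  have := P.universal X
  (ObjectProperty.ι _).mapIso ((restrict P.tmul P.isBirex X).asEquivalence.counitIso.app ⟨T, hT⟩)

/-- `F ⊠ G` for 1-morphisms `F : A ⟶ A'` and `G : B ⟶ B'`, determined by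
`(F ⊠ G) (a ⊠ b) ≅ F a ⊠ G b`. -/
noncomputable def Tensor.map {k : Type u} [Field k] {A A' B B' : RexCat.{u} k} (P : Tensor A B)
    (Q : Tensor A' B') (F : A ⟶ A') (G : B ⟶ B') : P.obj ⟶ Q.obj :=
  P.lift (functor F ⋙ Q.tmul ⋙ (Functor.whiskeringLeft _ _ _).obj (functor G))
    ⟨fun b => (isRex F).comp (Q.isBirex.left ((functor G).obj b)),
      fun a => (isRex G).comp (Q.isBirex.right ((functor F).obj a))⟩

/-- The (inverse) left unitor `C ⟶ Vect ⊠ C`, `c ↦ k ⊠ c`. -/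
def Tensor.leftUnit {k : Type u} [Field k] {C : RexCat.{u} k} (P : Tensor (vect k) C) :
    C ⟶ P.obj :=
  ofFunctor (P.tmul.obj (vectUnit k)) (P.isBirex.right _)

/-- The (inverse) right unitor `C ⟶ C ⊠ Vect`, `c ↦ c ⊠ k`. -/
def Tensor.rightUnit {k : Type u} [Field k] {C : RexCat.{u} k} (P : Tensor C (vect k)) :
    C ⟶ P.obj :=
  ofFunctor (P.tmul.flip.obj (vectUnit k)) (P.isBirex.left _)

/-- `α` is the associator `(A ⊠ B) ⊠ C ⟶ A ⊠ (B ⊠ C)`: the 1-morphism, unique up to isomorphism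
by the universal property, with `α ((a ⊠ b) ⊠ c) ≅ a ⊠ (b ⊠ c)` naturally in `a`, `b`, `c`. -/
def IsAssociator {k : Type u} [Field k] {A B C : RexCat.{u} k} (AB : Tensor A B)
    (ABthenC : Tensor AB.obj C) (BC : Tensor B C) (AthenBC : Tensor A BC.obj)
    (α : ABthenC.obj ⟶ AthenBC.obj) : Prop :=
  Nonempty (bifunctorComp₁₂ AB.tmul (postcomp ABthenC.tmul (functor α)) ≅
    bifunctorComp₂₃ AthenBC.tmul BC.tmul)

/-- `β` is the inverse associator `A ⊠ (B ⊠ C) ⟶ (A ⊠ B) ⊠ C`: the 1-morphism, unique up to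
isomorphism, with `β (a ⊠ (b ⊠ c)) ≅ (a ⊠ b) ⊠ c` naturally in `a`, `b`, `c`. -/
def IsAssociatorInv {k : Type u} [Field k] {A B C : RexCat.{u} k} (AB : Tensor A B)
    (ABthenC : Tensor AB.obj C) (BC : Tensor B C) (AthenBC : Tensor A BC.obj)
    (β : AthenBC.obj ⟶ ABthenC.obj) : Prop :=
  Nonempty (bifunctorComp₂₃ (postcomp AthenBC.tmul (functor β)) BC.tmul ≅
    bifunctorComp₁₂ AB.tmul ABthenC.tmul)

/-! ### Duality -/

/-- The first zigzag identity for `ev : D ⊠ C ⟶ Vect` and `coev : Vect ⟶ C ⊠ D`: the composite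
`C ≃ Vect ⊠ C ⟶ (C ⊠ D) ⊠ C ≃ C ⊠ (D ⊠ C) ⟶ C ⊠ Vect ≃ C` is isomorphic to the identity
(with the last equivalence moved to the other side). -/
def ZigzagLeft {k : Type u} [Field k] {C D : RexCat.{u} k} (DC : Tensor D C) (CD : Tensor C D)
    (ev : DC.obj ⟶ vect k) (coev : vect k ⟶ CD.obj) : Prop :=
  ∃ (VC : Tensor (vect k) C) (CDthenC : Tensor CD.obj C) (CthenDC : Tensor C DC.obj)
    (CV : Tensor C (vect k)) (α : CDthenC.obj ⟶ CthenDC.obj),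
    IsAssociator CD CDthenC DC CthenDC α ∧
    Nonempty (VC.leftUnit ≫ VC.map CDthenC coev (𝟙 C) ≫ α ≫ CthenDC.map CV (𝟙 C) ev ≅
      CV.rightUnit)

/-- The second zigzag identity: the composite
`D ≃ D ⊠ Vect ⟶ D ⊠ (C ⊠ D) ≃ (D ⊠ C) ⊠ D ⟶ Vect ⊠ D ≃ D` is isomorphic to the identity
(with the last equivalence moved to the other side). -/
def ZigzagRight {k : Type u} [Field k] {C D : RexCat.{u} k} (DC : Tensor D C) (CD : Tensor C D)
    (ev : DC.obj ⟶ vect k) (coev : vect k ⟶ CD.obj) : Prop :=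
  ∃ (DV : Tensor D (vect k)) (DthenCD : Tensor D CD.obj) (DCthenD : Tensor DC.obj D)
    (VD : Tensor (vect k) D) (β : DthenCD.obj ⟶ DCthenD.obj),
    IsAssociatorInv DC DCthenD CD DthenCD β ∧
    Nonempty (DV.rightUnit ≫ DV.map DthenCD (𝟙 D) coev ≫ β ≫ DCthenD.map VD ev (𝟙 D) ≅
      VD.leftUnit)

/-- A dual of `C` in the symmetric monoidal 2-category `Cat_k`: an object `C^∨`, a duality pairing
`ev : C^∨ ⊠ C ⟶ Vect` and a copairing `coev : Vect ⟶ C ⊠ C^∨` satisfying the zigzag identities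
up to isomorphism. -/
structure DualityData {k : Type u} [Field k] (C : RexCat.{u} k) where
  dual : RexCat.{u} k
  dualTensor : Tensor dual C
  tensorDual : Tensor C dual
  ev : dualTensor.obj ⟶ vect k
  coev : vect k ⟶ tensorDual.obj
  zigzagLeft : ZigzagLeft dualTensor tensorDual ev coev
  zigzagRight : ZigzagRight dualTensor tensorDual ev coev

/-- The duality pairing as a functor of two variables `(ξ, y) ↦ ⟨ξ | y⟩ = ev (ξ ⊠ y)`,
with values in vector spaces. -/
def DualityData.pairing {k : Type u} [Field k] {C : RexCat.{u} k} (d : DualityData C) :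
    d.dual.carrier ⥤ C.carrier ⥤ ModuleCat.{u} k :=
  d.dualTensor.tmul ⋙ (Functor.whiskeringRight _ _ _).obj (functor d.ev ⋙ vectInclusion k)

/-- `C` is 2-dualizable: it has a dual whose pairing and copairing have left and right adjoints
in the 2-category `Cat_k`. -/
def IsTwoDualizable {k : Type u} [Field k] (C : RexCat.{u} k) : Prop :=
  ∃ d : DualityData C,
    (Bicategory.IsLeftAdjoint d.ev ∧ Bicategory.IsRightAdjoint d.ev) ∧
    (Bicategory.IsLeftAdjoint d.coev ∧ Bicategory.IsRightAdjoint d.coev)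

/-! ### Finite semisimple abelian categories -/

/-- A `k`-linear category is finite semisimple abelian if it is abelian, it is finite (the spaces
of morphisms are finite-dimensional, every object has finite length, there are enough projectives
and finitely many simple objects up to isomorphism), and every object is a direct sum of (finitely
many) simple objects. -/
structure IsFiniteSemisimpleAbelian (k : Type u) [Field k] (C : Type (u + 1)) [Category.{u} C]
    [i : Preadditive C] [Linear k C] : Prop where
  abelian : ∃ A : Abelian C, A.toPreadditive = i
  finiteDimensional (X Y : C) : Module.Finite k (X ⟶ Y)
  finiteLength (X : C) : IsArtinianObject X ∧ IsNoetherianObject X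
  enoughProjectives : EnoughProjectives C
  finiteSimples : ∃ (n : ℕ) (S : Fin n → C), (∀ i, Simple (S i)) ∧
    ∀ X : C, Simple X → ∃ i, Nonempty (X ≅ S i)
  semisimple (X : C) : ∃ (n : ℕ) (S : Fin n → C), (∀ i, Simple (S i)) ∧
    ∃ b : Bicone S, Nonempty b.IsBilimit ∧ Nonempty (X ≅ b.pt)

end RexCat

/-!
A 2-dualizable object `C` of `Cat_k` is finite semisimple because its identity functor factors
through `Vect`.

Let `X` in `C ⊠ C^∨` be the image of `k` under the copairing. If the copairing has a right adjoint
in `Cat_k`, then `Hom (X, -)` is right exact. Every object of `C ⊠ C^∨` is covered by a finite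
family of pure tensors (`Tensor.covered_all`), so `X` is a direct summand of a finite sum of pure
tensors `c i ⊠ ξ i` (`Tensor.exists_sum_of_isLeftAdjoint`). The objects of `C ⊠ C^∨` act on `C` by
`(c ⊠ ξ) ⋆ y = ⟨ξ | y⟩ ⊗ c`, and the first zigzag identity says that `X` acts as the identity
(`DualityData.exists_leftAction`). Hence the identity functor of `C` is naturally a direct summand
of `y ↦ ⨁ i, ⟨ξ i | y⟩ ⊗ c i` (`VectFactorization`). Since epimorphisms split in `Vect` and
`⟨ξ i | -⟩` is right exact, they split in `C`; the spaces of morphisms are finite-dimensional, and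
every object is a direct summand of a finite sum of copies of the `c i`. An additive category with
cokernels in which epimorphisms split is von Neumann regular (`isRegular_of_epi_split`), and from
there abelianness, finite length and the decomposition into finitely many simple objects are
elementary (`IsRegular.isFiniteSemisimpleAbelian`).

Given this, let `C^∨` be any dual of `C`. Every linear functor out of `C` is right exact, so there
is a 1-morphism `Hom (x, -) ⊠ 1 : C ⊠ C^∨ ⟶ C^∨`, and `ξ_x` is the image of the copairing under it
(`DualityData.homDual`). Both `W ↦ ⟨(Hom (x, -) ⊠ 1) W | y⟩` and `W ↦ Hom (x, W ⋆ y)` send `c ⊠ η`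
to `Hom (x, c) ⊗ ⟨η | y⟩`, so they are isomorphic, and at the copairing this reads
`⟨ξ_x | y⟩ ≅ Hom (x, y)` (`DualityData.nonempty_homDual_vectPairing_iso`). The second zigzag
identity shows that `ξ ↦ ⟨ξ | -⟩` is faithful (`DualityData.vectPairing_faithful`); with the Yoneda
lemma this makes `x ↦ ξ_x` fully faithful. It is essentially surjective because every linear functor
`C ⥤ Vect` is corepresentable (`exists_homFunctor_iso`).
-/

namespace RexCat

/-! ### Von Neumann regular categories -/

/-- A category is von Neumann regular if every morphism `f` has a quasi-inverse `g`, that is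
`f ≫ g ≫ f = f`. -/
def IsRegular (C : Type*) [Category* C] : Prop :=
  ∀ ⦃X Y : C⦄ (f : X ⟶ Y), ∃ g : Y ⟶ X, f ≫ g ≫ f = f

theorem IsRegular.exists_section {C : Type*} [Category* C] (hC : IsRegular C) {X Y : C}
    (f : X ⟶ Y) [Epi f] : ∃ s : Y ⟶ X, s ≫ f = 𝟙 Y := by
  obtain ⟨g, hg⟩ := hC f
  exact ⟨g, by rw [← cancel_epi f, hg, Category.comp_id]⟩

theorem IsRegular.exists_retraction {C : Type*} [Category* C] (hC : IsRegular C) {X Y : C}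
    (f : X ⟶ Y) [Mono f] : ∃ s : Y ⟶ X, f ≫ s = 𝟙 X := by
  obtain ⟨g, hg⟩ := hC f
  exact ⟨g, by rw [← cancel_mono f, Category.assoc, hg, Category.id_comp]⟩

section Preadditive

variable {C : Type*} [Category* C] [Preadditive C]

/-- Idempotents split in a preadditive category with cokernels: the image of `e` is the cokernel
of `𝟙 - e`. -/
theorem exists_splitting [HasCokernels C] {X : C} (e : X ⟶ X) (he : e ≫ e = e) :
    ∃ (Y : C) (p : X ⟶ Y) (j : Y ⟶ X), p ≫ j = e ∧ j ≫ p = 𝟙 Y := by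
  have h0 : (𝟙 X - e) ≫ e = 0 := by simp [he]
  refine ⟨cokernel (𝟙 X - e), cokernel.π _, cokernel.desc _ e h0, by simp, ?_⟩
  rw [← cancel_epi (cokernel.π (𝟙 X - e)), ← Category.assoc, cokernel.π_desc]
  have := cokernel.condition (𝟙 X - e)
  rw [Preadditive.sub_comp, Category.id_comp, sub_eq_zero] at this
  rw [← this, Category.comp_id]

/-- If every epimorphism splits, then every morphism is the composite of a split epimorphism onto
its image and a split monomorphism. -/
theorem isRegular_of_epi_split [HasCokernels C]
    (h : ∀ {X Y : C} (f : X ⟶ Y) [Epi f], ∃ s : Y ⟶ X, s ≫ f = 𝟙 Y) : IsRegular C := by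
  intro X Y f
  obtain ⟨s, hs⟩ := h (cokernel.π f)
  have hsa {Z : C} (u : _ ⟶ Z) : s ≫ cokernel.π f ≫ u = u := by
    rw [← Category.assoc, hs, Category.id_comp]
  -- The image of `f` is the complement of the cokernel, cut out by the idempotent `𝟙 - π ≫ s`.
  obtain ⟨B, p, j, hpj, hjp⟩ := exists_splitting (𝟙 Y - cokernel.π f ≫ s) (by simp [hsa])
  have hsp : s ≫ p = 0 := by
    have : s ≫ (p ≫ j) ≫ p = s ≫ p := by rw [Category.assoc, hjp, Category.comp_id]
    rw [← this, hpj]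
    simp [hsa]
  have hf : f ≫ p ≫ j = f := by rw [hpj]; simp
  have : Epi (f ≫ p) := by
    refine Preadditive.epi_of_cancel_zero _ fun {Z} t ht => ?_
    rw [Category.assoc] at ht
    have h1 : cokernel.π f ≫ cokernel.desc f (p ≫ t) ht = p ≫ t := cokernel.π_desc _ _ _
    have h2 : cokernel.desc f (p ≫ t) ht = 0 := by
      rw [← hsa (cokernel.desc f (p ≫ t) ht), h1, ← Category.assoc, hsp, zero_comp]
    rw [h2, comp_zero] at h1
    rw [← Category.id_comp t, ← hjp, Category.assoc, ← h1, comp_zero]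
  obtain ⟨t, ht⟩ := h (f ≫ p)
  refine ⟨p ≫ t, ?_⟩
  calc f ≫ (p ≫ t) ≫ f = f ≫ p ≫ (t ≫ f ≫ p) ≫ j := by
        conv_lhs => rw [← hf]
        simp only [Category.assoc]
        simp only [← Category.assoc j p, hjp, Category.id_comp, hf]
    _ = f := by rw [ht, Category.id_comp, hf]

/-- The image and the kernel of a morphism `f` of a von Neumann regular category are direct
summands. -/
theorem IsRegular.exists_kernel [HasCokernels C] (hC : IsRegular C) {X Y : C} (f : X ⟶ Y) :
    ∃ (K : C) (p : X ⟶ K) (i : K ⟶ X) (g : Y ⟶ X), i ≫ p = 𝟙 K ∧ p ≫ i = 𝟙 X - f ≫ g ∧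
      i ≫ f = 0 ∧ f ≫ g ≫ f = f := by
  obtain ⟨g, hg⟩ := hC f
  have hga : f ≫ g ≫ f ≫ g = f ≫ g := by rw [← Category.assoc g, ← Category.assoc f, hg]
  obtain ⟨K, p, i, hpi, hip⟩ := exists_splitting (𝟙 X - f ≫ g) (by simp [hga])
  refine ⟨K, p, i, g, hip, hpi, ?_, hg⟩
  have h1 : i = i ≫ p ≫ i := by rw [← Category.assoc, hip, Category.id_comp]
  rw [h1, hpi]
  simp [hg]

/-- An additive functor out of a von Neumann regular category is right exact, since cokernels are
split there and hence absolute. -/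
theorem IsRegular.preservesFiniteColimits [HasFiniteColimits C] (hC : IsRegular C)
    {D : Type*} [Category* D] [Preadditive D] [HasFiniteColimits D] (F : C ⥤ D) [F.Additive] :
    PreservesFiniteColimits F := by
  have : HasFiniteBiproducts C := HasFiniteBiproducts.of_hasFiniteCoproducts
  have : HasBinaryBiproducts C := HasBinaryBiproducts.of_hasBinaryCoproducts
  have : HasZeroObject C := hasZeroObject_of_hasInitial_object
  have : HasZeroObject D := hasZeroObject_of_hasInitial_object
  have hcok {X Y : C} (f : X ⟶ Y) : PreservesColimit (parallelPair f 0) F := by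
    obtain ⟨g, hg⟩ := hC f
    have h0 : f ≫ (𝟙 Y - g ≫ f) = 0 := by simp [hg]
    have h1 : cokernel.π f ≫ cokernel.desc f _ h0 = 𝟙 Y - g ≫ f := cokernel.π_desc _ _ _
    have h2 : cokernel.desc f _ h0 ≫ cokernel.π f = 𝟙 _ := by
      rw [← cancel_epi (cokernel.π f), ← Category.assoc, h1]
      simp
    have hF0 : F.map f ≫ F.map (cokernel.π f) = 0 := by
      rw [← F.map_comp, cokernel.condition, F.map_zero]
    refine preservesColimit_of_preserves_colimit_cocone (cokernelIsCokernel f) ?_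
    refine (isColimitMapCoconeCoforkEquiv' F (cokernel.condition f)).symm ?_
    refine CokernelCofork.IsColimit.ofπ _ _ (fun t _ => F.map (cokernel.desc f _ h0) ≫ t)
      (fun t ht => ?_) (fun t _ m hm => ?_)
    · rw [← Category.assoc, ← F.map_comp, h1, F.map_sub, F.map_id, F.map_comp,
        Preadditive.sub_comp, Category.assoc, ht, comp_zero, sub_zero, Category.id_comp]
    · rw [← hm, ← Category.assoc, ← F.map_comp, h2, F.map_id, Category.id_comp]
  exact Functor.preservesFiniteColimits_of_preservesCokernels F

theorem IsRegular.hasKernels [HasCokernels C] (hC : IsRegular C) : HasKernels C :=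
  ⟨fun {X Y} f => by
    obtain ⟨K, p, i, g, hip, hpi, hif, hg⟩ := hC.exists_kernel f
    exact ⟨⟨⟨KernelFork.ofι i hif, KernelFork.IsLimit.ofι i hif (fun t _ => t ≫ p)
      (fun t ht => by
        rw [Category.assoc, hpi, Preadditive.comp_sub, ← Category.assoc t f, ht]; simp)
      (fun t _ m hm => by rw [← hm, Category.assoc, hip, Category.comp_id])⟩⟩⟩⟩

theorem IsRegular.exists_abelian [HasFiniteColimits C] (hC : IsRegular C) :
    ∃ A : Abelian C, A.toPreadditive = ‹Preadditive C› := by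
  have : HasFiniteBiproducts C := HasFiniteBiproducts.of_hasFiniteCoproducts
  have hfp : HasFiniteProducts C := inferInstance
  have hk : HasKernels C := hC.hasKernels
  have hm : IsNormalMonoCategory C := ⟨fun {X Y} f hf => by
    obtain ⟨g, hg⟩ := hC.exists_retraction f
    have hf0 : f ≫ (𝟙 Y - g ≫ f) = 0 := by rw [Preadditive.comp_sub, ← Category.assoc, hg]; simp
    exact ⟨⟨Y, 𝟙 Y - g ≫ f, hf0, KernelFork.IsLimit.ofι f hf0 (fun t _ => t ≫ g)
      (fun t ht => by
        rw [Preadditive.comp_sub, sub_eq_zero, Category.comp_id] at ht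
        rw [Category.assoc, ← ht])
      (fun t _ m hm => by rw [← hm, Category.assoc, hg, Category.comp_id])⟩⟩⟩
  have he : IsNormalEpiCategory C := ⟨fun {X Y} f hf => by
    obtain ⟨g, hg⟩ := hC.exists_section f
    have hf0 : (𝟙 X - f ≫ g) ≫ f = 0 := by
      rw [Preadditive.sub_comp, Category.assoc, hg]; simp
    exact ⟨⟨X, 𝟙 X - f ≫ g, hf0, CokernelCofork.IsColimit.ofπ f hf0 (fun t _ => g ≫ t)
      (fun t ht => by
        rw [Preadditive.sub_comp, sub_eq_zero, Category.id_comp] at ht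
        rw [← Category.assoc, ← ht])
      (fun t _ m hm => by rw [← hm, ← Category.assoc, hg, Category.id_comp])⟩⟩⟩
  exact ⟨{ ‹Preadditive C›, hm, he with }, rfl⟩

end Preadditive

theorem isRegular_fgModuleCat (k : Type u) [Field k] : IsRegular (FGModuleCat.{u} k) := by
  intro V W f
  obtain ⟨s, hs⟩ := f.hom.hom.rangeRestrict.exists_rightInverse_of_surjective
    (LinearMap.range_rangeRestrict _)
  obtain ⟨g, hg⟩ := LinearMap.exists_extend s
  refine ⟨FGModuleCat.ofHom g, ?_⟩
  ext x
  have h1 : g (f.hom.hom x) = s (f.hom.hom.rangeRestrict x) :=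
    LinearMap.congr_fun hg (f.hom.hom.rangeRestrict x)
  have h2 := congrArg Subtype.val (LinearMap.congr_fun hs (f.hom.hom.rangeRestrict x))
  change f.hom.hom (g (f.hom.hom x)) = f.hom.hom x
  rw [h1]
  exact h2

/-! ### Decomposition into simple objects -/

/-- A finite family of objects generates a preadditive category if every identity is a finite sum
of endomorphisms that factor through members of the family; equivalently, every object is a direct
summand of a finite direct sum of members of the family. -/
def IsGenerating {C : Type*} [Category* C] [Preadditive C] {ι : Type*} (c : ι → C) : Prop :=
  ∀ y : C, 𝟙 y ∈ AddSubmonoid.closure {f | ∃ (i : ι) (p : y ⟶ c i) (q : c i ⟶ y), p ≫ q = f}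

/-- A decomposition of `X` as a finite direct sum of simple objects. -/
structure SimpleDecomposition {C : Type*} [Category* C] [Preadditive C] (X : C) where
  ι : Type
  [fintype : Fintype ι]
  S : ι → C
  p (i : ι) : X ⟶ S i
  j (i : ι) : S i ⟶ X
  simple (i : ι) : Simple (S i)
  j_p (i : ι) : j i ≫ p i = 𝟙 (S i)
  j_p_ne (i i' : ι) (h : i ≠ i') : j i ≫ p i' = 0
  total : ∑ i, p i ≫ j i = 𝟙 X

attribute [instance] SimpleDecomposition.fintype

section

variable {k : Type*} [Field k] {C : Type*} [Category* C] [Preadditive C] [Linear k C]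

/-- The right ideal of endomorphisms of `X` with image in a subobject determines the subobject. -/
theorem IsRegular.exists_strictMono (k : Type*) [Field k] [Linear k C] (hC : IsRegular C)
    (X : C) : ∃ φ : Subobject X → Submodule k (X ⟶ X), StrictMono φ := by
  have key (A B : Subobject X) : LinearMap.range (Linear.rightComp k X A.arrow) ≤
      LinearMap.range (Linear.rightComp k X B.arrow) ↔ A ≤ B := by
    constructor
    · intro h
      obtain ⟨r, hr⟩ := hC.exists_retraction A.arrow
      obtain ⟨t, ht⟩ := h ⟨r, rfl⟩
      refine Subobject.le_of_comm (A.arrow ≫ t) ?_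
      have ht' : t ≫ B.arrow = r ≫ A.arrow := ht
      rw [Category.assoc, ht', ← Category.assoc, hr, Category.id_comp]
    · rintro h _ ⟨t, rfl⟩
      exact ⟨t ≫ Subobject.ofLE A B h, by simp⟩
  exact ⟨fun A => LinearMap.range (Linear.rightComp k X A.arrow),
    strictMono_of_le_iff_le fun A B => (key A B).symm⟩

theorem IsRegular.isArtinianObject (hC : IsRegular C) (X : C) [Module.Finite k (X ⟶ X)] :
    IsArtinianObject X := by
  obtain ⟨φ, hφ⟩ := hC.exists_strictMono k X
  exact ⟨hφ.wellFoundedLT⟩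

theorem IsRegular.isNoetherianObject (hC : IsRegular C) (X : C) [Module.Finite k (X ⟶ X)] :
    IsNoetherianObject X := by
  obtain ⟨φ, hφ⟩ := hC.exists_strictMono k X
  exact ⟨hφ.wellFoundedGT⟩

/-- A proper direct summand has a smaller endomorphism algebra. -/
theorem finrank_end_lt {X A : C} [Module.Finite k (X ⟶ X)] (p : X ⟶ A) (i : A ⟶ X)
    (h : i ≫ p = 𝟙 A) (hne : p ≫ i ≠ 𝟙 X) :
    Module.finrank k (A ⟶ A) < Module.finrank k (X ⟶ X) := by
  let φ : (A ⟶ A) →ₗ[k] (X ⟶ X) := Linear.leftComp k X p ∘ₗ Linear.rightComp k A i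
  have hφ (f : A ⟶ A) : φ f = p ≫ f ≫ i := rfl
  have hinj : Function.Injective φ := by
    intro f g hfg
    have := congrArg (fun t => i ≫ t ≫ p) hfg
    simp only [hφ, Category.assoc, h, Category.comp_id] at this
    simpa only [← Category.assoc, h, Category.id_comp] using this
  refine lt_of_le_of_ne (LinearMap.finrank_le_finrank_of_injective hinj) fun heq => hne ?_
  have : Module.Finite k (A ⟶ A) := Module.Finite.of_injective φ hinj
  obtain ⟨f, hf⟩ := (LinearMap.injective_iff_surjective_of_finrank_eq_finrank heq).1 hinj (𝟙 X)
  rw [hφ] at hf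
  have h2 : i ≫ (p ≫ f ≫ i) ≫ p = 𝟙 A := by rw [hf, Category.id_comp, h]
  simp only [Category.assoc, h, Category.comp_id] at h2
  rw [← Category.assoc, h, Category.id_comp] at h2
  rw [h2, Category.id_comp] at hf
  exact hf

/-- The decompositions of two complementary direct summands combine. -/
theorem SimpleDecomposition.nonempty_of_summands {X A B : C} (p : X ⟶ A) (i : A ⟶ X) (q : X ⟶ B)
    (j : B ⟶ X) (hip : i ≫ p = 𝟙 A) (hjq : j ≫ q = 𝟙 B) (htot : p ≫ i + q ≫ j = 𝟙 X)
    (a : SimpleDecomposition A) (b : SimpleDecomposition B) :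
    Nonempty (SimpleDecomposition X) := by
  have hiq : i ≫ q = 0 := by
    have h : i ≫ (p ≫ i + q ≫ j) ≫ q = i ≫ q := by rw [htot, Category.id_comp]
    simp only [Preadditive.add_comp, Preadditive.comp_add, Category.assoc, hjq, Category.comp_id]
      at h
    rw [← Category.assoc i p, hip, Category.id_comp] at h
    simpa using h
  have hjp : j ≫ p = 0 := by
    have h : j ≫ (p ≫ i + q ≫ j) ≫ p = j ≫ p := by rw [htot, Category.id_comp]
    simp only [Preadditive.add_comp, Preadditive.comp_add, Category.assoc, hip, Category.comp_id]
      at h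
    rw [← Category.assoc j q, hjq, Category.id_comp] at h
    simpa using h
  have hip' {Z : C} (t : A ⟶ Z) : i ≫ p ≫ t = t := by rw [← Category.assoc, hip, Category.id_comp]
  have hjq' {Z : C} (t : B ⟶ Z) : j ≫ q ≫ t = t := by rw [← Category.assoc, hjq, Category.id_comp]
  have hiq' {Z : C} (t : B ⟶ Z) : i ≫ q ≫ t = 0 := by rw [← Category.assoc, hiq, zero_comp]
  have hjp' {Z : C} (t : A ⟶ Z) : j ≫ p ≫ t = 0 := by rw [← Category.assoc, hjp, zero_comp]
  refine ⟨{ ι := a.ι ⊕ b.ι, S := Sum.elim a.S b.S, p := ?_, j := ?_, simple := ?_, j_p := ?_,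
            j_p_ne := ?_, total := ?_ }⟩
  · exact fun | .inl s => p ≫ a.p s | .inr s => q ≫ b.p s
  · exact fun | .inl s => a.j s ≫ i | .inr s => b.j s ≫ j
  · exact fun | .inl s => a.simple s | .inr s => b.simple s
  · rintro (s | s)
    · change (a.j s ≫ i) ≫ p ≫ a.p s = 𝟙 _
      rw [Category.assoc, hip', a.j_p]
    · change (b.j s ≫ j) ≫ q ≫ b.p s = 𝟙 _
      rw [Category.assoc, hjq', b.j_p]
  · rintro (s | s) (t | t) h
    · change (a.j s ≫ i) ≫ p ≫ a.p t = 0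
      rw [Category.assoc, hip', a.j_p_ne s t (fun h' => h (by rw [h']))]
    · change (a.j s ≫ i) ≫ q ≫ b.p t = 0
      rw [Category.assoc, hiq', comp_zero]
    · change (b.j s ≫ j) ≫ p ≫ a.p t = 0
      rw [Category.assoc, hjp', comp_zero]
    · change (b.j s ≫ j) ≫ q ≫ b.p t = 0
      rw [Category.assoc, hjq', b.j_p_ne s t (fun h' => h (by rw [h']))]
  · rw [Fintype.sum_sum_type]
    have ha : ∑ s, p ≫ (a.p s ≫ a.j s) ≫ i = p ≫ i := by
      rw [← Preadditive.comp_sum, ← Preadditive.sum_comp, a.total, Category.id_comp]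
    have hb : ∑ s, q ≫ (b.p s ≫ b.j s) ≫ j = q ≫ j := by
      rw [← Preadditive.comp_sum, ← Preadditive.sum_comp, b.total, Category.id_comp]
    simp only [Category.assoc] at ha hb
    change ∑ s, (p ≫ a.p s) ≫ a.j s ≫ i + ∑ s, (q ≫ b.p s) ≫ b.j s ≫ j = 𝟙 X
    simp only [Category.assoc]
    rw [ha, hb, htot]

variable [HasCokernels C]

theorem IsRegular.nonempty_simpleDecomposition (hC : IsRegular C)
    (hfin : ∀ X : C, Module.Finite k (X ⟶ X)) (X : C) : Nonempty (SimpleDecomposition X) := by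
  induction hn : Module.finrank k (X ⟶ X) using Nat.strong_induction_on generalizing X with
  | _ n ih =>
    subst hn
    by_cases h0 : 𝟙 X = 0
    · exact ⟨{ ι := Empty, S := Empty.elim, p := (·.elim), j := (·.elim), simple := (·.elim),
               j_p := (·.elim), j_p_ne := fun i => i.elim, total := by simp [h0] }⟩
    by_cases hs : Simple X
    · exact ⟨{ ι := Unit, S := fun _ => X, p := fun _ => 𝟙 X, j := fun _ => 𝟙 X,
               simple := fun _ => hs, j_p := by simp, j_p_ne := fun i j h => (h rfl).elim,
               total := by simp }⟩
    obtain ⟨A, i, hi, hi0, hiso⟩ : ∃ (A : C) (i : A ⟶ X), Mono i ∧ i ≠ 0 ∧ ¬ IsIso i := by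
      by_contra! H
      refine hs ⟨fun {A} i hi => ⟨?_, H A i hi⟩⟩
      rintro hiso rfl
      refine h0 ?_
      rw [← IsIso.inv_hom_id (0 : A ⟶ X), comp_zero]
    obtain ⟨p, hp⟩ := hC.exists_retraction i
    have hp' {Z : C} (t : A ⟶ Z) : i ≫ p ≫ t = t := by rw [← Category.assoc, hp, Category.id_comp]
    obtain ⟨B, q, j, hqj, hjq⟩ := exists_splitting (𝟙 X - p ≫ i) (by simp [hp'])
    have hA : p ≫ i ≠ 𝟙 X := fun h => hiso ⟨p, hp, h⟩
    have hB : q ≫ j ≠ 𝟙 X := by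
      rw [hqj]
      intro h
      have h1 : p ≫ i = 0 := by simpa using h
      exact hi0 (by rw [← hp' i, h1, comp_zero])
    obtain ⟨a⟩ := ih _ (finrank_end_lt p i hp hA) A rfl
    obtain ⟨b⟩ := ih _ (finrank_end_lt q j hjq hB) B rfl
    exact SimpleDecomposition.nonempty_of_summands p i q j hp hjq (by rw [hqj]; simp) a b

end

theorem SimpleDecomposition.exists_bicone {C : Type*} [Category* C] [Preadditive C] {X : C}
    (a : SimpleDecomposition X) : ∃ (n : ℕ) (S : Fin n → C), (∀ i, Simple (S i)) ∧
      ∃ b : Bicone S, Nonempty b.IsBilimit ∧ Nonempty (X ≅ b.pt) := by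
  let e := (Fintype.equivFin a.ι).symm
  let b : Bicone (a.S ∘ e) :=
    { pt := X
      π := fun i => a.p (e i)
      ι := fun i => a.j (e i)
      ι_π := fun i i' => by
        by_cases h : i = i'
        · subst h
          simpa using a.j_p (e i)
        · rw [dif_neg h]
          exact a.j_p_ne _ _ fun h' => h (e.injective h') }
  exact ⟨_, a.S ∘ e, fun i => a.simple (e i), b,
    ⟨isBilimitOfTotal b (by rw [← a.total]; exact e.sum_comp fun i => a.p i ≫ a.j i)⟩,
    ⟨Iso.refl X⟩⟩

/-- A simple object maps nontrivially to a member of a generating family, hence to one of the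
simple summands of that member. -/
theorem IsRegular.exists_simples {C : Type*} [Category* C] [Preadditive C] [HasCokernels C]
    [HasFiniteBiproducts C] (hC : IsRegular C) {ι : Type} [Finite ι] {c : ι → C}
    (hc : IsGenerating c) (a : ∀ X : C, Nonempty (SimpleDecomposition X)) :
    ∃ (n : ℕ) (S : Fin n → C), (∀ i, Simple (S i)) ∧
      ∀ X : C, Simple X → ∃ i, Nonempty (X ≅ S i) := by
  have := hC.hasKernels
  have := Fintype.ofFinite ι
  let a (i : ι) := (a (c i)).some
  let e := (Fintype.equivFin (Σ i, (a i).ι)).symm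
  refine ⟨_, fun n => (a (e n).1).S (e n).2, fun n => (a (e n).1).simple (e n).2, fun X hX => ?_⟩
  obtain ⟨i, p, hp⟩ : ∃ (i : ι) (p : X ⟶ c i), p ≠ 0 := by
    by_contra! H
    refine id_nonzero X ?_
    refine AddSubmonoid.closure_induction (motive := fun f _ => f = 0) ?_ rfl ?_ (hc X)
    · rintro _ ⟨i, p, q, rfl⟩
      rw [H i p, zero_comp]
    · rintro f g _ _ rfl rfl
      exact add_zero 0
  obtain ⟨s, hs⟩ : ∃ s, p ≫ (a i).p s ≠ 0 := by
    by_contra! H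
    refine hp ?_
    rw [← Category.comp_id p, ← (a i).total, Preadditive.comp_sum]
    exact Finset.sum_eq_zero fun s _ => by rw [← Category.assoc, H s, zero_comp]
  have := (a i).simple s
  have := isIso_of_hom_simple hs
  refine ⟨e.symm ⟨i, s⟩, ⟨asIso (p ≫ (a i).p s) ≪≫
    eqToIso (congrArg (fun z : Σ i, (a i).ι => (a z.1).S z.2) (e.apply_symm_apply ⟨i, s⟩).symm)⟩⟩

theorem IsRegular.isFiniteSemisimpleAbelian {k : Type u} [Field k] {C : Type (u + 1)}
    [Category.{u} C] [Preadditive C] [Linear k C] [HasFiniteColimits C] (hC : IsRegular C)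
    (hfin : ∀ X Y : C, Module.Finite k (X ⟶ Y)) {ι : Type} [Finite ι] {c : ι → C}
    (hc : IsGenerating c) : IsFiniteSemisimpleAbelian k C := by
  have : HasFiniteBiproducts C := HasFiniteBiproducts.of_hasFiniteCoproducts
  have a (X : C) := hC.nonempty_simpleDecomposition (fun X => hfin X X) X
  exact
    { abelian := hC.exists_abelian
      finiteDimensional := hfin
      finiteLength := fun X =>
        have := hfin X X
        ⟨hC.isArtinianObject (k := k) X, hC.isNoetherianObject (k := k) X⟩
      enoughProjectives := ⟨fun X => ⟨{
        p := X
        projective := ⟨fun {E Y} f g hg => by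
          obtain ⟨s, hs⟩ := hC.exists_section g
          exact ⟨f ≫ s, by rw [Category.assoc, hs, Category.comp_id]⟩⟩
        f := 𝟙 X }⟩⟩
      finiteSimples := hC.exists_simples hc a
      semisimple := fun X => (a X).some.exists_bicone }

/-! ### Tensoring an object with a finite-dimensional vector space -/

section Copower

variable {k : Type u} [Field k] {D : Type*} [Category.{u} D] [Preadditive D] [Linear k D]
  [HasFiniteBiproducts D]

/-- The copower `V ⊗ d` of an object `d` by a finite-dimensional vector space `V`, realized as a
direct sum of copies of `d` indexed by a basis of `V`. -/
noncomputable def copower (V : FGModuleCat.{u} k) (d : D) : D :=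
  ⨁ fun _ : Fin (Module.finrank k V) => d

namespace copower

/-- The morphism `d ⟶ V ⊗ d`, `x ↦ v ⊗ x`, as a linear function of `v`. -/
noncomputable def ins (V : FGModuleCat.{u} k) (d : D) : V →ₗ[k] (d ⟶ copower V d) :=
  (Module.finBasis k V).constr k fun i => biproduct.ι (fun _ => d) i

/-- The universal property of `V ⊗ d`: a morphism out of it is a linear map from `V` to a space of
morphisms out of `d`. -/
noncomputable def desc {V : FGModuleCat.{u} k} {d e : D} (φ : V →ₗ[k] (d ⟶ e)) :
    copower V d ⟶ e :=
  biproduct.desc fun i => φ (Module.finBasis k V i)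

theorem ins_basis (V : FGModuleCat.{u} k) (d : D) (i : Fin (Module.finrank k V)) :
    ins V d (Module.finBasis k V i) = biproduct.ι (fun _ => d) i :=
  (Module.finBasis k V).constr_basis k _ i

theorem ins_desc {V : FGModuleCat.{u} k} {d e : D} (φ : V →ₗ[k] (d ⟶ e)) (v : V) :
    ins V d v ≫ desc φ = φ v := by
  suffices h : Linear.rightComp k d (desc φ) ∘ₗ ins V d = φ from LinearMap.congr_fun h v
  refine (Module.finBasis k V).ext fun i => ?_
  rw [LinearMap.comp_apply, ins_basis]
  exact biproduct.ι_desc (fun i => φ (Module.finBasis k V i)) i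

theorem ins_desc_assoc {V : FGModuleCat.{u} k} {d e f : D} (φ : V →ₗ[k] (d ⟶ e)) (v : V)
    (h : e ⟶ f) : ins V d v ≫ desc φ ≫ h = φ v ≫ h := by
  rw [← Category.assoc, ins_desc]

attribute [simp] ins_desc ins_desc_assoc

theorem hom_ext {V : FGModuleCat.{u} k} {d e : D} {f g : copower V d ⟶ e}
    (h : ∀ v, ins V d v ≫ f = ins V d v ≫ g) : f = g := by
  refine biproduct.hom_ext' _ _ fun i => ?_
  have := h (Module.finBasis k V i)
  rwa [ins_basis] at this

/-- The morphism `V ⊗ d ⟶ d` given by a basis coordinate on `V`. -/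
noncomputable def proj (V : FGModuleCat.{u} k) (d : D) (i : Fin (Module.finrank k V)) :
    copower V d ⟶ d :=
  desc (((Module.finBasis k V).coord i).smulRight (𝟙 d))

theorem ins_proj (V : FGModuleCat.{u} k) (d : D) (v : V) (i : Fin (Module.finrank k V)) :
    ins V d v ≫ proj V d i = (Module.finBasis k V).repr v i • 𝟙 d := by
  simp [proj]

theorem ins_proj_assoc (V : FGModuleCat.{u} k) (d : D) (v : V) (i : Fin (Module.finrank k V))
    {e : D} (h : d ⟶ e) :
    ins V d v ≫ proj V d i ≫ h = ((Module.finBasis k V).repr v i • 𝟙 d) ≫ h := by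
  rw [← Category.assoc, ins_proj]

attribute [simp] ins_proj ins_proj_assoc

theorem sum_repr_smul_ins (V : FGModuleCat.{u} k) (d : D) (v : V) :
    ∑ i, (Module.finBasis k V).repr v i • ins V d (Module.finBasis k V i) = ins V d v := by
  conv_rhs => rw [← (Module.finBasis k V).sum_repr v]
  rw [map_sum]
  exact Finset.sum_congr rfl fun i _ => (map_smul _ _ _).symm

theorem sum_proj_ins (V : FGModuleCat.{u} k) (d : D) :
    ∑ i, proj V d i ≫ ins V d (Module.finBasis k V i) = 𝟙 (copower V d) := by
  refine hom_ext fun v => ?_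
  simp only [Preadditive.comp_sum, ins_proj_assoc, Linear.smul_comp, Category.id_comp,
    Category.comp_id]
  exact sum_repr_smul_ins V d v

/-- The functoriality of `V ⊗ d` in both variables. -/
noncomputable def map {V W : FGModuleCat.{u} k} (f : V ⟶ W) {d e : D} (g : d ⟶ e) :
    copower V d ⟶ copower W e :=
  desc (Linear.leftComp k _ g ∘ₗ ins W e ∘ₗ f.hom.hom)

theorem ins_map {V W : FGModuleCat.{u} k} (f : V ⟶ W) {d e : D} (g : d ⟶ e) (v : V) :
    ins V d v ≫ map f g = g ≫ ins W e (f.hom.hom v) := by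
  simp [map]

theorem ins_map_assoc {V W : FGModuleCat.{u} k} (f : V ⟶ W) {d e e' : D} (g : d ⟶ e) (v : V)
    (h : copower W e ⟶ e') : ins V d v ≫ map f g ≫ h = g ≫ ins W e (f.hom.hom v) ≫ h := by
  rw [← Category.assoc, ins_map, Category.assoc]

attribute [simp] ins_map ins_map_assoc

@[simp]
theorem map_id (V : FGModuleCat.{u} k) (d : D) : map (𝟙 V) (𝟙 d) = 𝟙 (copower V d) :=
  hom_ext fun v => by simp

theorem map_comp {U V W : FGModuleCat.{u} k} (f : U ⟶ V) (f' : V ⟶ W) {c d e : D} (g : c ⟶ d)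
    (g' : d ⟶ e) : map (f ≫ f') (g ≫ g') = map f g ≫ map f' g' :=
  hom_ext fun v => by simp

theorem map_add_right {V W : FGModuleCat.{u} k} (f : V ⟶ W) {d e : D} (g g' : d ⟶ e) :
    map f (g + g') = map f g + map f g' :=
  hom_ext fun v => by simp

theorem map_smul_right {V W : FGModuleCat.{u} k} (f : V ⟶ W) {d e : D} (r : k) (g : d ⟶ e) :
    map f (r • g) = r • map f g :=
  hom_ext fun v => by simp

theorem map_add_left {V W : FGModuleCat.{u} k} (f f' : V ⟶ W) {d e : D} (g : d ⟶ e) :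
    map (f + f') g = map f g + map f' g :=
  hom_ext fun v => by
    have h : (f + f').hom.hom v = f.hom.hom v + f'.hom.hom v := rfl
    simp [h]

theorem map_smul_left {V W : FGModuleCat.{u} k} (r : k) (f : V ⟶ W) {d e : D} (g : d ⟶ e) :
    map (r • f) g = r • map f g :=
  hom_ext fun v => by
    have h : (r • f).hom.hom v = r • f.hom.hom v := rfl
    simp [h]

end copower

/-- The bifunctor `(V, d) ↦ V ⊗ d`. -/
@[simps]
noncomputable def copowerFunctor (k : Type u) [Field k] (D : Type*) [Category.{u} D]
    [Preadditive D] [Linear k D] [HasFiniteBiproducts D] : FGModuleCat.{u} k ⥤ D ⥤ D where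
  obj V :=
    { obj := fun d => copower V d
      map := fun g => copower.map (𝟙 V) g
      map_id := fun d => copower.map_id V d
      map_comp := fun g h => by rw [← copower.map_comp, Category.comp_id] }
  map f :=
    { app := fun d => copower.map f (𝟙 d)
      naturality := fun d e g => by simp [← copower.map_comp] }
  map_id V := by
    ext d
    exact copower.map_id V d
  map_comp f g := by
    ext d
    simp [← copower.map_comp]

instance copowerFunctor_obj_additive (V : FGModuleCat.{u} k) :
    ((copowerFunctor k D).obj V).Additive where
  map_add := copower.map_add_right _ _ _

instance copowerFunctor_obj_linear (V : FGModuleCat.{u} k) :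
    ((copowerFunctor k D).obj V).Linear k where
  map_smul f r := copower.map_smul_right _ r f

instance (d : D) : ((copowerFunctor k D).flip.obj d).Additive where
  map_add := copower.map_add_left _ _ _

instance (d : D) : ((copowerFunctor k D).flip.obj d).Linear k where
  map_smul f r := copower.map_smul_left r f _

theorem copowerFunctor_preservesFiniteColimits (V : FGModuleCat.{u} k) [HasFiniteColimits D] :
    PreservesFiniteColimits ((copowerFunctor k D).obj V) := by
  have : HasBinaryBiproducts D := HasBinaryBiproducts.of_hasBinaryCoproducts
  have hcok {X Y : D} (f : X ⟶ Y) :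
      PreservesColimit (parallelPair f 0) ((copowerFunctor k D).obj V) := by
    refine preservesColimit_of_preserves_colimit_cocone (cokernelIsCokernel f) ?_
    refine (isColimitMapCoconeCoforkEquiv' _ (cokernel.condition f)).symm ?_
    have h0 {T : D} (t : copower V Y ⟶ T) (ht : copower.map (𝟙 V) f ≫ t = 0) (v : V) :
        f ≫ copower.ins V Y v ≫ t = 0 := by
      have := copower.ins V X v ≫= ht
      simpa using this
    have hdesc {T : D} (t : copower V Y ⟶ T) (ht : copower.map (𝟙 V) f ≫ t = 0) :
        ∃ φ : V →ₗ[k] (cokernel f ⟶ T), ∀ v, cokernel.π f ≫ φ v = copower.ins V Y v ≫ t :=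
      ⟨{ toFun := fun v => cokernel.desc f (copower.ins V Y v ≫ t) (h0 t ht v)
         map_add' := fun v w => by
          rw [← cancel_epi (cokernel.π f)]
          simp only [Preadditive.comp_add, cokernel.π_desc, map_add, Preadditive.add_comp]
         map_smul' := fun r v => by
          rw [← cancel_epi (cokernel.π f)]
          simp only [RingHom.id_apply, Linear.comp_smul, cokernel.π_desc, map_smul,
            Linear.smul_comp] }, fun v => cokernel.π_desc _ _ _⟩
    choose φ hφ using @hdesc
    refine CokernelCofork.IsColimit.ofπ _ _ (fun {T} t ht => copower.desc (φ t ht)) ?_ ?_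
    · intro T t ht
      refine copower.hom_ext fun v => ?_
      refine (copower.ins_map_assoc _ _ _ _).trans ?_
      rw [copower.ins_desc]
      exact hφ t ht v
    · intro T t ht m hm
      refine copower.hom_ext fun v => ?_
      rw [copower.ins_desc, ← cancel_epi (cokernel.π f)]
      refine Eq.trans ?_ (hφ t ht v).symm
      rw [← hm]
      exact (copower.ins_map_assoc (𝟙 V) (cokernel.π f) v m).symm
  exact Functor.preservesFiniteColimits_of_preservesCokernels _

/-- The isomorphism `k ⊗ d ≅ d` for a single object. -/
noncomputable def copower.unitIso (k : Type u) [Field k] {D : Type*} [Category.{u} D]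
    [Preadditive D] [Linear k D] [HasFiniteBiproducts D] (d : D) :
    copower (FGModuleCat.of k k) d ≅ d where
  hom := copower.desc (LinearMap.toSpanSingleton k _ (𝟙 d))
  inv := copower.ins (FGModuleCat.of k k) d (1 : k)
  hom_inv_id := copower.hom_ext fun v => by
    rw [copower.ins_desc_assoc, LinearMap.toSpanSingleton_apply, Linear.smul_comp,
      Category.id_comp, Category.comp_id]
    exact ((copower.ins (FGModuleCat.of k k) d).map_smul v (1 : k)).symm.trans
      (congrArg _ (mul_one v))
  inv_hom_id := (copower.ins_desc _ _).trans (one_smul k _)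

/-- The canonical natural isomorphism `k ⊗ d ≅ d`. -/
noncomputable def copowerUnitIso (k : Type u) [Field k] (D : Type*) [Category.{u} D]
    [Preadditive D] [Linear k D] [HasFiniteBiproducts D] :
    (copowerFunctor k D).obj (FGModuleCat.of k k) ≅ 𝟭 D :=
  NatIso.ofComponents (fun d => copower.unitIso k d) fun {d e} g => by
    change copower.map (𝟙 _) g ≫ (copower.unitIso k e).hom = (copower.unitIso k d).hom ≫ g
    refine copower.hom_ext fun v => ?_
    rw [copower.ins_map_assoc, copower.unitIso, copower.unitIso, copower.ins_desc,
      copower.ins_desc_assoc]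
    simp

section Comparison

variable {E : Type*} [Category.{u} E] [Preadditive E] [Linear k E] [HasFiniteBiproducts E]
  (F : D ⥤ E) [F.Additive] [F.Linear k]

/-- A `k`-linear functor commutes with copowers. -/
noncomputable def copower.comparison (V : FGModuleCat.{u} k) (d : D) :
    copower V (F.obj d) ≅ F.obj (copower V d) where
  hom := copower.desc (F.mapLinearMap k ∘ₗ copower.ins V d)
  inv := ∑ i, F.map (copower.proj V d i) ≫ copower.ins V (F.obj d) (Module.finBasis k V i)
  hom_inv_id := copower.hom_ext fun v => by
    rw [copower.ins_desc_assoc]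
    simp only [Preadditive.comp_sum, LinearMap.comp_apply, Functor.coe_mapLinearMap,
      ← Category.assoc, ← F.map_comp, copower.ins_proj, F.map_smul, F.map_id, Linear.smul_comp,
      Category.id_comp, Category.comp_id]
    exact copower.sum_repr_smul_ins V _ v
  inv_hom_id := by
    simp only [Preadditive.sum_comp, Category.assoc, copower.ins_desc, LinearMap.comp_apply,
      Functor.coe_mapLinearMap, ← F.map_comp]
    rw [← F.map_sum, copower.sum_proj_ins, F.map_id]

theorem copower.ins_comparison_hom (V : FGModuleCat.{u} k) (d : D) (v : V) :
    copower.ins V (F.obj d) v ≫ (copower.comparison F V d).hom = F.map (copower.ins V d v) := by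
  simp [copower.comparison]

theorem copower.ins_comparison_hom_assoc (V : FGModuleCat.{u} k) (d : D) (v : V) {e : E}
    (h : F.obj (copower V d) ⟶ e) :
    copower.ins V (F.obj d) v ≫ (copower.comparison F V d).hom ≫ h =
      F.map (copower.ins V d v) ≫ h := by
  rw [← Category.assoc, copower.ins_comparison_hom]

attribute [simp] copower.ins_comparison_hom copower.ins_comparison_hom_assoc

end Comparison

end Copower

variable {k : Type u} [Field k]

instance (C : RexCat.{u} k) : HasFiniteBiproducts C.carrier :=
  HasFiniteBiproducts.of_hasFiniteCoproducts

/-- The action `(V, c) ↦ V ⊗ c` of `Vect` on an object of `Cat_k`. -/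
noncomputable def act (C : RexCat.{u} k) : (vect k).carrier ⥤ C.carrier ⥤ C.carrier :=
  copowerFunctor k C.carrier

theorem act_isBirex (C : RexCat.{u} k) : IsBirex (act C) where
  left c :=
    { additive := inferInstanceAs ((copowerFunctor k C.carrier).flip.obj c).Additive
      linear := inferInstanceAs (((copowerFunctor k C.carrier).flip.obj c).Linear k)
      preservesFiniteColimits :=
        (isRegular_fgModuleCat k).preservesFiniteColimits
          ((copowerFunctor k C.carrier).flip.obj c) }
  right V :=
    { additive := copowerFunctor_obj_additive (k := k) V
      linear := copowerFunctor_obj_linear (k := k) V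
      preservesFiniteColimits := copowerFunctor_preservesFiniteColimits (k := k) V }

theorem IsBirex.flip {C D E : RexCat.{u} k} {T : C.carrier ⥤ D.carrier ⥤ E.carrier}
    (hT : IsBirex T) : IsBirex T.flip :=
  ⟨hT.right, hT.left⟩

/-! ### Consequences of the universal property of the tensor product -/

namespace Tensor

variable {C D : RexCat.{u} k} (P : Tensor C D)

/-- Natural transformations between right exact functors on `C ⊠ D` are determined by their
values on pure tensors. -/
theorem natTrans_ext {X : RexCat.{u} k} {F G : P.obj.carrier ⥤ X.carrier} (hF : IsRex k F)
    (hG : IsRex k G) {η θ : F ⟶ G}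
    (h : ∀ c d, η.app ((P.tmul.obj c).obj d) = θ.app ((P.tmul.obj c).obj d)) : η = θ := by
  have := P.universal X
  have h' : (ObjectProperty.homMk η : (⟨F, hF⟩ : Rex P.obj X) ⟶ ⟨G, hG⟩) =
      ObjectProperty.homMk θ := by
    refine (restrict P.tmul P.isBirex X).map_injective ?_
    ext c d
    exact h c d
  exact congrArg (fun t => t.hom) h'

theorem exists_natTrans {X : RexCat.{u} k} {F G : P.obj.carrier ⥤ X.carrier} (hF : IsRex k F)
    (hG : IsRex k G) (e : postcomp P.tmul F ⟶ postcomp P.tmul G) :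
    ∃ η : F ⟶ G, ∀ c d, η.app ((P.tmul.obj c).obj d) = (e.app c).app d := by
  have := P.universal X
  obtain ⟨η, hη⟩ := (restrict P.tmul P.isBirex X).map_surjective
    (X := (⟨F, hF⟩ : Rex P.obj X)) (Y := ⟨G, hG⟩) (ObjectProperty.homMk e)
  refine ⟨η.hom, fun c d => ?_⟩
  exact congrArg (fun t => (t.hom.app c).app d) hη

/-- Natural transformations between right exact functors on `C ⊠ D`, depending functorially on a
parameter, may be prescribed on pure tensors. -/
theorem exists_natTrans_param {A : Type*} [Category* A] {X : RexCat.{u} k}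
    {F G : P.obj.carrier ⥤ A ⥤ X.carrier} (hF : ∀ a, IsRex k (F.flip.obj a))
    (hG : ∀ a, IsRex k (G.flip.obj a))
    (e : bifunctorComp₁₂ P.tmul F ⟶ bifunctorComp₁₂ P.tmul G) :
    ∃ η : F ⟶ G, ∀ c d, η.app ((P.tmul.obj c).obj d) = (e.app c).app d := by
  have h (a : A) := P.exists_natTrans (hF a) (hG a)
    { app := fun c =>
        { app := fun d => ((e.app c).app d).app a
          naturality := fun d d' f => congrArg (fun t => t.app a) ((e.app c).naturality f) }
      naturality := fun c c' f => by
        ext d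
        exact congrArg (fun t => (t.app d).app a) (e.naturality f) }
  choose η hη using h
  have hnat {a a' : A} (f : a ⟶ a') : η a ≫ G.flip.map f = F.flip.map f ≫ η a' := by
    refine P.natTrans_ext (hF a) (hG a') fun c d => ?_
    simp only [NatTrans.comp_app, hη]
    exact (((e.app c).app d).naturality f).symm
  refine ⟨{ app := fun W => { app := fun a => (η a).app W, naturality := fun a a' f => ?_ }
            naturality := fun W W' f => ?_ }, fun c d => ?_⟩
  · exact (congrArg (fun t => t.app W) (hnat f)).symm
  · ext a
    exact (η a).naturality f
  · ext a
    exact hη a c d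

theorem nonempty_iso_param {A : Type*} [Category* A] {X : RexCat.{u} k}
    {F G : P.obj.carrier ⥤ A ⥤ X.carrier} (hF : ∀ a, IsRex k (F.flip.obj a))
    (hG : ∀ a, IsRex k (G.flip.obj a))
    (e : bifunctorComp₁₂ P.tmul F ≅ bifunctorComp₁₂ P.tmul G) : Nonempty (F ≅ G) := by
  obtain ⟨η, hη⟩ := P.exists_natTrans_param hF hG e.hom
  obtain ⟨θ, hθ⟩ := P.exists_natTrans_param hG hF e.inv
  have key {F : P.obj.carrier ⥤ A ⥤ X.carrier} (hF : ∀ a, IsRex k (F.flip.obj a)) (η : F ⟶ F)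
      (h : ∀ c d, η.app ((P.tmul.obj c).obj d) = 𝟙 _) : η = 𝟙 F := by
    ext W a
    refine congrArg (fun t => t.app W) (P.natTrans_ext (hF a) (hF a)
      (η := (Functor.whiskerRight η ((evaluation _ _).obj a) : _ ⟶ _)) (θ := 𝟙 _) fun c d => ?_)
    exact congrArg (fun t => t.app a) (h c d)
  refine ⟨⟨η, θ, key hF _ fun c d => ?_, key hG _ fun c d => ?_⟩⟩
  · rw [NatTrans.comp_app, hη, hθ]
    exact congrArg (fun t => (t.app c).app d) e.hom_inv_id
  · rw [NatTrans.comp_app, hη, hθ]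
    exact congrArg (fun t => (t.app c).app d) e.inv_hom_id

theorem nonempty_iso {X : RexCat.{u} k} {F G : P.obj.carrier ⥤ X.carrier} (hF : IsRex k F)
    (hG : IsRex k G) (e : postcomp P.tmul F ≅ postcomp P.tmul G) : Nonempty (F ≅ G) := by
  have := P.universal X
  exact ⟨(ObjectProperty.ι _).mapIso ((restrict P.tmul P.isBirex X).preimageIso
    (X := (⟨F, hF⟩ : Rex P.obj X)) (Y := ⟨G, hG⟩) (ObjectProperty.isoMk _ e))⟩

/-- The objects of `C ⊠ D` covered by finitely many pure tensors: those admitting a finite jointly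
epimorphic family of morphisms from pure tensors. -/
def covered : ObjectProperty P.obj.carrier := fun W =>
  ∃ (ι : Type) (_ : Finite ι) (c : ι → C.carrier) (d : ι → D.carrier)
    (q : ∀ i, (P.tmul.obj (c i)).obj (d i) ⟶ W),
    ∀ ⦃Z : P.obj.carrier⦄ (f g : W ⟶ Z), (∀ i, q i ≫ f = q i ≫ g) → f = g

theorem covered_tmul (c : C.carrier) (d : D.carrier) : P.covered ((P.tmul.obj c).obj d) :=
  ⟨Unit, inferInstance, fun _ => c, fun _ => d, fun _ => 𝟙 _, fun Z f g h => by simpa using h ()⟩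

instance (J : Type) [SmallCategory J] [FinCategory J] :
    P.covered.IsClosedUnderColimitsOfShape J where
  colimitsOfShape_le := by
    rintro W ⟨p⟩
    choose ι hι c d q hq using p.prop_diag_obj
    refine ⟨Σ j, ι j, inferInstance, fun x => c x.1 x.2, fun x => d x.1 x.2,
      fun x => q x.1 x.2 ≫ p.ι.app x.1, fun Z f g h => ?_⟩
    refine p.isColimit.hom_ext fun j => hq j _ _ fun i => ?_
    simpa using h ⟨j, i⟩

/-- The full subcategory of covered objects, as an object of `Cat_k`. -/
def coveredRex : RexCat.{u} k where
  carrier := P.covered.FullSubcategory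
  hasFiniteColimits := ⟨fun _ _ _ => inferInstance⟩
  essentiallySmall := essentiallySmall_of_fully_faithful P.covered.ι

/-- The inclusion of the covered objects. -/
def coveredInclusion : P.coveredRex.carrier ⥤ P.obj.carrier := P.covered.ι

theorem isRex_coveredInclusion : IsRex k P.coveredInclusion where
  additive := { map_add := rfl }
  linear := { map_smul := fun _ _ => rfl }
  preservesFiniteColimits := ⟨fun J _ _ =>
    inferInstanceAs (PreservesColimitsOfShape J P.covered.ι)⟩

/-- The functor `(c, d) ↦ c ⊠ d` with values in the covered objects. -/
def coveredTmul : C.carrier ⥤ D.carrier ⥤ P.coveredRex.carrier where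
  obj c := P.covered.lift (P.tmul.obj c) fun d => P.covered_tmul c d
  map f := { app := fun d => ObjectProperty.homMk ((P.tmul.map f).app d)
             naturality := fun d d' g => ObjectProperty.hom_ext _ ((P.tmul.map f).naturality g) }
  map_id c := by ext d; exact ObjectProperty.hom_ext _ (congrArg (fun t => t.app d) (P.tmul.map_id c))
  map_comp f g := by
    ext d
    exact ObjectProperty.hom_ext _ (congrArg (fun t => t.app d) (P.tmul.map_comp f g))

/-- A functor is right exact if its composite with the inclusion of the covered objects is. -/
theorem isRex_of_coveredInclusion {B : RexCat.{u} k} (F : B.carrier ⥤ P.coveredRex.carrier)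
    (hF : IsRex k (F ⋙ P.coveredInclusion)) : IsRex k F where
  additive := { map_add := fun {_ _ _ _} => ObjectProperty.hom_ext _ hF.additive.map_add }
  linear := { map_smul := fun f r => ObjectProperty.hom_ext _ (hF.linear.map_smul f r) }
  preservesFiniteColimits := ⟨fun J _ _ => by
    have := hF.preservesFiniteColimits
    have : ReflectsColimitsOfShape J P.coveredInclusion :=
      inferInstanceAs (ReflectsColimitsOfShape J P.covered.ι)
    exact preservesColimitsOfShape_of_reflects_of_preserves F P.coveredInclusion⟩

theorem coveredTmul_isBirex : IsBirex P.coveredTmul where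
  left d := P.isRex_of_coveredInclusion _ (P.isBirex.left d)
  right c := P.isRex_of_coveredInclusion _ (P.isBirex.right c)

/-- Every object of `C ⊠ D` is covered by finitely many pure tensors: by the universal property,
the identity of `C ⊠ D` factors through the full subcategory of covered objects. -/
theorem covered_all (W : P.obj.carrier) : P.covered W := by
  let L := P.lift P.coveredTmul P.coveredTmul_isBirex
  obtain ⟨e⟩ : Nonempty (functor L ⋙ P.coveredInclusion ≅ 𝟭 _) :=
    P.nonempty_iso ((isRex L).comp P.isRex_coveredInclusion) (IsRex.id k _)
      (Functor.isoWhiskerRight (P.liftIso P.coveredTmul P.coveredTmul_isBirex)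
        ((Functor.whiskeringRight _ _ _).obj P.coveredInclusion))
  obtain ⟨ι, hι, c, d, q, hq⟩ : P.covered ((functor L ⋙ P.coveredInclusion).obj W) :=
    ((functor L).obj W).property
  refine ⟨ι, hι, c, d, fun i => q i ≫ e.hom.app W, fun Z f g h => ?_⟩
  rw [← cancel_epi (e.hom.app W)]
  exact hq _ _ fun i => by simpa only [Category.assoc] using h i

/-- If a 1-morphism `Vect ⟶ C ⊠ D` has a right adjoint in `Cat_k`, then the identity of the image
`X` of `k` is a sum of endomorphisms which factor through pure tensors: `Hom (X, -)` is right
exact, so that `X` is a direct summand of a finite sum of pure tensors covering it. -/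
theorem exists_sum_of_isLeftAdjoint (f : vect k ⟶ P.obj) (hf : Bicategory.IsLeftAdjoint f) :
    ∃ (ι : Type) (_ : Fintype ι) (c : ι → C.carrier) (d : ι → D.carrier)
      (a : ∀ i, (functor f).obj (vectUnit k) ⟶ (P.tmul.obj (c i)).obj (d i))
      (b : ∀ i, (P.tmul.obj (c i)).obj (d i) ⟶ (functor f).obj (vectUnit k)),
      ∑ i, a i ≫ b i = 𝟙 _ := by
  let adj := Bicategory.Adjunction.ofIsLeftAdjoint f
  let r := Bicategory.rightAdjoint f
  let X := (functor f).obj (vectUnit k)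
  let η : vectUnit k ⟶ (functor r).obj X := adj.unit.hom.app (vectUnit k)
  let ε (Z : P.obj.carrier) : (functor f).obj ((functor r).obj Z) ⟶ Z := adj.counit.hom.app Z
  have hε {Z Z' : P.obj.carrier} (g : Z ⟶ Z') :
      (functor f).map ((functor r).map g) ≫ ε Z' = ε Z ≫ g := adj.counit.hom.naturality g
  have htri : (functor f).map η ≫ ε X = 𝟙 X := by
    have h := congrArg (fun t => t.hom.app (vectUnit k)) adj.left_triangle
    simp only [Bicategory.leftZigzag, bicategoricalComp, BicategoricalCoherence.assoc_iso,
      BicategoricalCoherence.whiskerRight_iso, BicategoricalCoherence.refl_iso, Iso.trans_hom,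
      Bicategory.whiskerRightIso_hom, Iso.refl_hom, Bicategory.whiskerRight_comp,
      Bicategory.id_whiskerRight, Category.id_comp, Iso.inv_hom_id, Category.comp_id] at h
    have h' : (functor f).map η ≫ 𝟙 _ ≫ ε X = 𝟙 X ≫ 𝟙 X := h
    simpa using h'
  obtain ⟨ι, hι, c, d, q, hq⟩ := P.covered_all X
  have := Fintype.ofFinite ι
  let Z : P.obj.carrier := ⨁ fun i => (P.tmul.obj (c i)).obj (d i)
  let p : Z ⟶ X := biproduct.desc q
  have hp : Epi p := ⟨fun g h hgh => hq _ _ fun i => by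
    have := biproduct.ι (fun i => (P.tmul.obj (c i)).obj (d i)) i ≫= hgh
    simpa [p] using this⟩
  have := (isRex r).preservesFiniteColimits
  have hreg : IsRegular (vect k).carrier := isRegular_fgModuleCat k
  obtain ⟨s, hs⟩ := hreg.exists_section ((functor r).map p)
  refine ⟨ι, inferInstance, c, d,
    fun i => (functor f).map (η ≫ s) ≫ ε Z ≫ biproduct.π _ i, q, ?_⟩
  have h1 : ∑ i, biproduct.π (fun i => (P.tmul.obj (c i)).obj (d i)) i ≫ q i = p := by
    simp [p, biproduct.desc_eq]
  simp only [Category.assoc]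
  rw [← Preadditive.comp_sum, ← Preadditive.comp_sum, h1, ← hε, ← Category.assoc,
    ← Functor.map_comp, Category.assoc, hs, Category.comp_id, htri]

end Tensor

/-! ### The actions of `C ⊠ D` defined by a duality -/

/-- The natural isomorphism `k ⊗ c ≅ c`. -/
noncomputable def actUnitIso (C : RexCat.{u} k) : (act C).obj (vectUnit k) ≅ 𝟭 C.carrier :=
  copowerUnitIso k C.carrier

/-- The natural isomorphism of functors underlying a 2-isomorphism of `Cat_k`. -/
def functorIso {C D : RexCat.{u} k} {F G : C ⟶ D} (e : F ≅ G) : functor F ≅ functor G :=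
  (ObjectProperty.ι _).mapIso e

namespace DualityData

variable {C : RexCat.{u} k} (d : DualityData C)

/-- The duality pairing with values in finite-dimensional vector spaces. -/
def vectPairing : d.dual.carrier ⥤ C.carrier ⥤ (vect k).carrier :=
  postcomp d.dualTensor.tmul (functor d.ev)

theorem vectPairing_isBirex : IsBirex d.vectPairing :=
  d.dualTensor.isBirex.postcomp (isRex d.ev)

/-- The image of `k` under the copairing. -/
def copairing : d.tensorDual.obj.carrier := (functor d.coev).obj (vectUnit k)

/-- The first zigzag identity: `C ⊠ C^∨` acts on `C` by `(c ⊠ ξ) ⋆ y = ⟨ξ | y⟩ ⊗ c`, and the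
copairing acts as the identity. -/
theorem exists_leftAction : ∃ T : d.tensorDual.obj.carrier ⥤ C.carrier ⥤ C.carrier,
    IsBirex T ∧
    Nonempty (bifunctorComp₁₂ d.tensorDual.tmul T ≅
      bifunctorComp₂₃ (act C).flip d.vectPairing) ∧
    Nonempty (T.obj d.copairing ≅ 𝟭 C.carrier) := by
  obtain ⟨VC, CDthenC, CthenDC, CV, α, ⟨h⟩, ⟨z⟩⟩ := d.zigzagLeft
  let m : CV.obj ⟶ C := CV.lift (act C).flip (act_isBirex C).flip
  let M := CthenDC.map CV (𝟙 C) d.ev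
  let K := functor M ⋙ functor m
  have hm : postcomp CV.tmul (functor m) ≅ (act C).flip := CV.liftIso _ _
  have hM : postcomp CthenDC.tmul (functor M) ≅
      CV.tmul ⋙ (Functor.whiskeringLeft _ _ _).obj (functor d.ev) := CthenDC.liftIso _ _
  have hK : postcomp CthenDC.tmul K ≅
      (act C).flip ⋙ (Functor.whiskeringLeft _ _ _).obj (functor d.ev) :=
    Functor.isoWhiskerRight hM ((Functor.whiskeringRight _ _ _).obj (functor m)) ≪≫
      Functor.isoWhiskerRight hm ((Functor.whiskeringLeft _ _ _).obj (functor d.ev))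
  let T := postcomp CDthenC.tmul (functor α ⋙ K)
  refine ⟨T, CDthenC.isBirex.postcomp ((isRex α).comp ((isRex M).comp (isRex m))), ⟨?_⟩, ⟨?_⟩⟩
  · exact (Functor.isoWhiskerRight h
        ((Functor.whiskeringRight _ _ _).obj ((Functor.whiskeringRight _ _ _).obj K)) :) ≪≫
      ((bifunctorComp₂₃Functor.mapIso hK).app d.dualTensor.tmul :)
  · have hV : VC.tmul.obj (vectUnit k) ⋙ functor (VC.map CDthenC d.coev (𝟙 C)) ≅
        CDthenC.tmul.obj d.copairing :=
      (VC.liftIso _ _).app (vectUnit k)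
    exact (Functor.isoWhiskerRight hV (functor α ⋙ K)).symm ≪≫
      (Functor.isoWhiskerRight (functorIso z) (functor m) :) ≪≫
      ((evaluation _ _).obj (vectUnit k)).mapIso ((flipFunctor _ _ _).mapIso hm) ≪≫
      actUnitIso C

/-- The second zigzag identity: `C ⊠ C^∨` acts on `C^∨` by `ξ ⋆ (c ⊠ η) = ⟨ξ | c⟩ ⊗ η`, and the
copairing acts as the identity. -/
theorem exists_rightAction : ∃ T : d.dual.carrier ⥤ d.tensorDual.obj.carrier ⥤ d.dual.carrier,
    IsBirex T ∧
    Nonempty (bifunctorComp₂₃ T d.tensorDual.tmul ≅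
      bifunctorComp₁₂ d.vectPairing (act d.dual)) ∧
    Nonempty (T.flip.obj d.copairing ≅ 𝟭 d.dual.carrier) := by
  obtain ⟨DV, DthenCD, DCthenD, VD, β, ⟨h⟩, ⟨z⟩⟩ := d.zigzagRight
  let m : VD.obj ⟶ d.dual := VD.lift (act d.dual) (act_isBirex d.dual)
  let M := DCthenD.map VD d.ev (𝟙 d.dual)
  let K := functor M ⋙ functor m
  have hm : postcomp VD.tmul (functor m) ≅ act d.dual := VD.liftIso _ _
  have hM : postcomp DCthenD.tmul (functor M) ≅ functor d.ev ⋙ VD.tmul := DCthenD.liftIso _ _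
  have hK : postcomp DCthenD.tmul K ≅ functor d.ev ⋙ act d.dual :=
    Functor.isoWhiskerRight hM ((Functor.whiskeringRight _ _ _).obj (functor m)) ≪≫
      Functor.isoWhiskerLeft (functor d.ev) hm
  let T := postcomp DthenCD.tmul (functor β ⋙ K)
  refine ⟨T, DthenCD.isBirex.postcomp ((isRex β).comp ((isRex M).comp (isRex m))), ⟨?_⟩, ⟨?_⟩⟩
  · exact (Functor.isoWhiskerRight h
        ((Functor.whiskeringRight _ _ _).obj ((Functor.whiskeringRight _ _ _).obj K)) :) ≪≫
      ((bifunctorComp₁₂Functor.obj d.dualTensor.tmul).mapIso hK :)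
  · have hV : DV.tmul.flip.obj (vectUnit k) ⋙ functor (DV.map DthenCD (𝟙 d.dual) d.coev) ≅
        DthenCD.tmul.flip.obj d.copairing :=
      ((flipFunctor _ _ _).mapIso (DV.liftIso _ _)).app (vectUnit k)
    exact (Functor.isoWhiskerRight hV (functor β ⋙ K)).symm ≪≫
      (Functor.isoWhiskerRight (functorIso z) (functor m) :) ≪≫
      hm.app (vectUnit k) ≪≫ actUnitIso d.dual

end DualityData

/-! ### Semisimplicity of a 2-dualizable object -/

/-- A factorization of the identity functor through `Vect`: natural transformations which exhibit
`𝟭 C` as a direct summand of a finite sum of functors `y ↦ V i y ⊗ c i`, where each `V i` is a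
1-morphism `C ⟶ Vect`. -/
structure VectFactorization (C : RexCat.{u} k) where
  ι : Type
  [fintype : Fintype ι]
  V : ι → C.carrier ⥤ (vect k).carrier
  isRex (i : ι) : IsRex k (V i)
  c : ι → C.carrier
  α (i : ι) : 𝟭 C.carrier ⟶ V i ⋙ (act C).flip.obj (c i)
  β (i : ι) : V i ⋙ (act C).flip.obj (c i) ⟶ 𝟭 C.carrier
  total (y : C.carrier) : ∑ i, (α i).app y ≫ (β i).app y = 𝟙 y

attribute [instance] VectFactorization.fintype

/-- If the copairing has a right adjoint, then it is a direct summand of a finite sum of pure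
tensors `c ⊠ ξ`; these act on `C` through `⟨ξ | -⟩`, and the copairing acts as the identity. -/
theorem DualityData.nonempty_vectFactorization {C : RexCat.{u} k} (d : DualityData C)
    (h : Bicategory.IsLeftAdjoint d.coev) : Nonempty (VectFactorization C) := by
  obtain ⟨ι, _, c, ξ, a, b, hab⟩ : ∃ (ι : Type) (_ : Fintype ι) (c : ι → C.carrier)
      (ξ : ι → d.dual.carrier)
      (a : ∀ i, d.copairing ⟶ (d.tensorDual.tmul.obj (c i)).obj (ξ i))
      (b : ∀ i, (d.tensorDual.tmul.obj (c i)).obj (ξ i) ⟶ d.copairing),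
      ∑ i, a i ≫ b i = 𝟙 d.copairing :=
    d.tensorDual.exists_sum_of_isLeftAdjoint d.coev h
  obtain ⟨T, hT, ⟨e⟩, ⟨z⟩⟩ := d.exists_leftAction
  let e' (i : ι) : T.obj ((d.tensorDual.tmul.obj (c i)).obj (ξ i)) ≅
      d.vectPairing.obj (ξ i) ⋙ (act C).flip.obj (c i) := (e.app (c i)).app (ξ i)
  refine ⟨{ ι := ι, V := fun i => d.vectPairing.obj (ξ i),
            isRex := fun i => d.vectPairing_isBirex.right (ξ i), c := c
            α := fun i => z.inv ≫ T.map (a i) ≫ (e' i).hom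
            β := fun i => (e' i).inv ≫ T.map (b i) ≫ z.hom
            total := fun y => ?_ }⟩
  have hcomp (i : ι) : (z.inv ≫ T.map (a i) ≫ (e' i).hom) ≫ (e' i).inv ≫ T.map (b i) ≫ z.hom =
      z.inv ≫ T.map (a i ≫ b i) ≫ z.hom := by
    simp only [Category.assoc, Iso.hom_inv_id_assoc, T.map_comp]
  have := (hT.left y).additive
  have hsum : ∑ i, (T.map (a i ≫ b i)).app y = 𝟙 _ :=
    ((T.flip.obj y).map_sum _ _).symm.trans
      ((congrArg (T.flip.obj y).map hab).trans ((T.flip.obj y).map_id _))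
  calc _ = ∑ i, z.inv.app y ≫ (T.map (a i ≫ b i)).app y ≫ z.hom.app y :=
        Finset.sum_congr rfl fun i _ => congrArg (fun t => t.app y) (hcomp i)
    _ = z.inv.app y ≫ (∑ i, (T.map (a i ≫ b i)).app y) ≫ z.hom.app y := by
        rw [Preadditive.sum_comp, Preadditive.comp_sum]
    _ = 𝟙 y := by
        rw [hsum]
        exact (z.inv.app y ≫= Category.id_comp _).trans (z.inv_hom_id_app y)

theorem finite_vect_hom (V W : (vect k).carrier) : Module.Finite k (V ⟶ W) :=
  have h (V W : FGModuleCat.{u} k) : Module.Finite k (V ⟶ W) := inferInstance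
  h V W

namespace VectFactorization

variable {C : RexCat.{u} k}

/-- Linear maps `V i x ⟶ V i y` induce a morphism `x ⟶ y`. -/
noncomputable def ofMaps (f : VectFactorization C) {x y : C.carrier} (g : ∀ i, (f.V i).obj x ⟶ (f.V i).obj y) : x ⟶ y :=
  ∑ i, (f.α i).app x ≫ ((act C).flip.obj (f.c i)).map (g i) ≫ (f.β i).app y

theorem ofMaps_map (f : VectFactorization C) {x y : C.carrier} (g : x ⟶ y) : f.ofMaps (fun i => (f.V i).map g) = g := by
  have h (i : f.ι) : (f.α i).app x ≫ ((act C).flip.obj (f.c i)).map ((f.V i).map g) ≫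
      (f.β i).app y = ((f.α i).app x ≫ (f.β i).app x) ≫ g := by
    rw [Category.assoc]
    exact _ ≫= (f.β i).naturality g
  rw [ofMaps, Finset.sum_congr rfl fun i _ => h i, ← Preadditive.sum_comp, f.total]
  exact Category.id_comp g

/-- `Hom (x, y)` is a quotient of the finite-dimensional space `∏ i, Hom (V i x, V i y)`. -/
theorem finite_hom (f : VectFactorization C) (x y : C.carrier) : Module.Finite k (x ⟶ y) := by
  let φ : (∀ i, (f.V i).obj x ⟶ (f.V i).obj y) →ₗ[k] (x ⟶ y) :=
    { toFun := f.ofMaps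
      map_add' := fun g h => by
        have (i : f.ι) := ((act_isBirex C).left (f.c i)).additive
        simp only [ofMaps, Pi.add_apply, Functor.map_add, Preadditive.add_comp,
          Preadditive.comp_add, Finset.sum_add_distrib]
      map_smul' := fun r g => by
        have (i : f.ι) := ((act_isBirex C).left (f.c i)).additive
        have (i : f.ι) := ((act_isBirex C).left (f.c i)).linear
        simp only [ofMaps, Pi.smul_apply, Functor.map_smul, Linear.smul_comp,
          Linear.comp_smul, Finset.smul_sum, RingHom.id_apply] }
  have (i : f.ι) : Module.Finite k ((f.V i).obj x ⟶ (f.V i).obj y) :=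
    finite_vect_hom _ _
  exact Module.Finite.of_surjective φ fun g => ⟨_, f.ofMaps_map g⟩

/-- Epimorphisms split in `C`: a right exact functor to `Vect` sends them to split epimorphisms,
and sections in `Vect` induce a section in `C`. -/
theorem isRegular (f : VectFactorization C) : IsRegular C.carrier := by
  refine isRegular_of_epi_split fun {x y} g _ => ?_
  have hreg : IsRegular (vect k).carrier := isRegular_fgModuleCat k
  have hs (i : f.ι) : ∃ s, s ≫ (f.V i).map g = 𝟙 _ := by
    have := (f.isRex i).preservesFiniteColimits
    exact hreg.exists_section ((f.V i).map g)
  choose s hs using hs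
  refine ⟨f.ofMaps s, ?_⟩
  have h (i : f.ι) : ((f.α i).app y ≫ ((act C).flip.obj (f.c i)).map (s i) ≫ (f.β i).app x) ≫ g =
      (f.α i).app y ≫ (f.β i).app y := by
    have hn : (f.β i).app x ≫ g =
      ((act C).flip.obj (f.c i)).map ((f.V i).map g) ≫ (f.β i).app y :=
      ((f.β i).naturality g).symm
    rw [Category.assoc, Category.assoc, hn, ← Category.assoc (((act C).flip.obj (f.c i)).map _),
      ← Functor.map_comp, hs, CategoryTheory.Functor.map_id]
    exact _ ≫= Category.id_comp _
  rw [ofMaps, Preadditive.sum_comp, Finset.sum_congr rfl fun i _ => h i, f.total]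

theorem isGenerating (f : VectFactorization C) : IsGenerating f.c := by
  intro y
  rw [← f.total y]
  refine AddSubmonoid.sum_mem _ fun i _ => ?_
  let V : FGModuleCat.{u} k := (f.V i).obj y
  let a : y ⟶ copower V (f.c i) := (f.α i).app y
  let b : copower V (f.c i) ⟶ y := (f.β i).app y
  have h : a ≫ b = ∑ j, (a ≫ copower.proj V (f.c i) j) ≫
      copower.ins V (f.c i) (Module.finBasis k V j) ≫ b := by
    simp only [Category.assoc]
    rw [← Preadditive.comp_sum]
    simp only [← Category.assoc (copower.proj V (f.c i) _)]
    rw [← Preadditive.sum_comp, copower.sum_proj_ins, Category.id_comp]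
  change a ≫ b ∈ _
  rw [h]
  exact AddSubmonoid.sum_mem _ fun j _ => AddSubmonoid.subset_closure ⟨i, _, _, rfl⟩

theorem isFiniteSemisimpleAbelian (f : VectFactorization C) :
    IsFiniteSemisimpleAbelian k C.carrier :=
  f.isRegular.isFiniteSemisimpleAbelian f.finite_hom f.isGenerating

end VectFactorization

/-! ### Corepresentability of linear functors on a semisimple category -/

theorem map_comp_hom_apply {C : Type*} [Category* C] (F : C ⥤ ModuleCat.{u} k) {x y z : C}
    (f : x ⟶ y) (g : y ⟶ z) (e : F.obj x) :
    (F.map (f ≫ g)).hom e = (F.map g).hom ((F.map f).hom e) := by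
  rw [F.map_comp]
  rfl

section Corepresentable

variable {C : Type*} [Category.{u} C] [Preadditive C] (F : C ⥤ ModuleCat.{u} k)
  [F.Additive]

/-- A linear functor with finite-dimensional values is generated by a single element as soon as a
finite family of objects generates the category. -/
theorem exists_generator [Linear k C] [F.Linear k] [HasFiniteBiproducts C]
    (hF : ∀ y, Module.Finite k (F.obj y)) {ι : Type} [Fintype ι] {c : ι → C}
    (hc : IsGenerating c) :
    ∃ (p : C) (e : F.obj p), ∀ (y : C) (z : F.obj y), ∃ f : p ⟶ y, (F.map f).hom e = z := by
  let S := Σ i, Fin (Module.finrank k (F.obj (c i)))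
  let b (i : ι) := Module.finBasis k (F.obj (c i))
  let c' : S → C := fun s => c s.1
  let e : F.obj (⨁ c') := ∑ s : S, (F.map (biproduct.ι c' s)).hom (b s.1 s.2)
  have he (s : S) : (F.map (biproduct.π c' s)).hom e = b s.1 s.2 := by
    rw [map_sum, Finset.sum_eq_single s]
    · rw [← map_comp_hom_apply, biproduct.ι_π_self, F.map_id]
      rfl
    · intro t _ hts
      rw [← map_comp_hom_apply, biproduct.ι_π_ne c' hts, F.map_zero]
      rfl
    · simp
  have hgen (i : ι) (z : F.obj (c i)) : ∃ f : ⨁ c' ⟶ c i, (F.map f).hom e = z := by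
    refine ⟨∑ j, (b i).repr z j • biproduct.π c' ⟨i, j⟩, ?_⟩
    rw [F.map_sum, ModuleCat.hom_sum, LinearMap.sum_apply]
    conv_rhs => rw [← (b i).sum_repr z]
    refine Finset.sum_congr rfl fun j _ => ?_
    rw [F.map_smul]
    exact congrArg _ (he ⟨i, j⟩)
  refine ⟨⨁ c', e, fun y z => ?_⟩
  have h : ∃ f : ⨁ c' ⟶ y, (F.map f).hom e = (F.map (𝟙 y)).hom z := by
    refine AddSubmonoid.closure_induction
      (motive := fun h _ => ∃ f : ⨁ c' ⟶ y, (F.map f).hom e = (F.map h).hom z) ?_ ?_ ?_ (hc y)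
    · rintro _ ⟨i, p, q, rfl⟩
      obtain ⟨f, hf⟩ := hgen i ((F.map p).hom z)
      exact ⟨f ≫ q, by rw [map_comp_hom_apply, map_comp_hom_apply, hf]⟩
    · exact ⟨0, by rw [F.map_zero, F.map_zero]; rfl⟩
    · rintro g h _ _ ⟨f, hf⟩ ⟨f', hf'⟩
      refine ⟨f + f', ?_⟩
      rw [F.map_add, F.map_add, ModuleCat.hom_add, ModuleCat.hom_add, LinearMap.add_apply,
        LinearMap.add_apply, hf, hf']
  rwa [F.map_id] at h

/-- Restricting a generator to a minimal subobject makes it universal: an element killed by `t`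
comes from the kernel of `t`, which is a direct summand. -/
theorem IsRegular.exists_universal_element [HasCokernels C] (hC : IsRegular C)
    (hart : ∀ x : C, IsArtinianObject x)
    (h : ∃ (p : C) (e : F.obj p), ∀ (y : C) (z : F.obj y), ∃ f : p ⟶ y, (F.map f).hom e = z) :
    ∃ (x : C) (e : F.obj x), ∀ (y : C) (z : F.obj y), ∃! f : x ⟶ y, (F.map f).hom e = z := by
  obtain ⟨p, e, he⟩ := h
  have := hart p
  let S : Set (Subobject p) := {K | ∃ e' : F.obj (K : C), (F.map K.arrow).hom e' = e}
  have hS {N : C} (j : N ⟶ p) [Mono j] (e' : F.obj N) (h : (F.map j).hom e' = e) :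
      Subobject.mk j ∈ S :=
    ⟨(F.map (Subobject.underlyingIso j).inv).hom e', by
      rw [← map_comp_hom_apply, Subobject.underlyingIso_arrow, h]⟩
  have hne : S.Nonempty := ⟨Subobject.mk (𝟙 p), hS (𝟙 p) e (by rw [F.map_id]; rfl)⟩
  obtain ⟨K, ⟨e', he'⟩, hmin⟩ := wellFounded_lt.has_min S hne
  have hinj {y : C} (t : (K : C) ⟶ y) (ht : (F.map t).hom e' = 0) : t = 0 := by
    obtain ⟨N, q, i, g, hiq, hqi, hit, -⟩ := hC.exists_kernel t
    have : Mono i := mono_of_mono_fac hiq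
    have hN : Subobject.mk (i ≫ K.arrow) ∈ S := by
      refine hS _ ((F.map q).hom e') ?_
      rw [← map_comp_hom_apply, ← Category.assoc, hqi, map_comp_hom_apply, F.map_sub, F.map_id,
        ModuleCat.hom_sub, LinearMap.sub_apply, map_comp_hom_apply, ht, map_zero, sub_zero]
      exact he'
    have hle : Subobject.mk (i ≫ K.arrow) ≤ K := Subobject.mk_le_of_comm i rfl
    have hKle : K ≤ Subobject.mk (i ≫ K.arrow) := by
      by_contra hK
      exact hmin _ hN (lt_of_le_not_ge hle hK)
    have hu : Subobject.ofLEMk K (i ≫ K.arrow) hKle ≫ i = 𝟙 _ := by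
      rw [← cancel_mono K.arrow, Category.assoc, Subobject.ofLEMk_comp, Category.id_comp]
    rw [← Category.id_comp t, ← hu, Category.assoc, hit, comp_zero]
  refine ⟨(K : C), e', fun y z => ?_⟩
  obtain ⟨f, hf⟩ := he y z
  refine ⟨K.arrow ≫ f, ?_, fun g hg => ?_⟩
  · change (F.map (K.arrow ≫ f)).hom e' = z
    rw [map_comp_hom_apply, he', hf]
  · rw [← sub_eq_zero]
    refine hinj _ ?_
    rw [F.map_sub, ModuleCat.hom_sub, LinearMap.sub_apply, map_comp_hom_apply, he', hf, sub_eq_zero]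
    exact hg

theorem nonempty_linearCoyoneda_iso [Linear k C] [F.Linear k] {x : C} (e : F.obj x)
    (he : ∀ (y : C) (z : F.obj y), ∃! f : x ⟶ y, (F.map f).hom e = z) :
    Nonempty ((linearCoyoneda k C).obj (Opposite.op x) ≅ F) := by
  let φ (y : C) : (x ⟶ y) →ₗ[k] F.obj y :=
    { toFun := fun f => (F.map f).hom e
      map_add' := fun f g => by rw [F.map_add]; rfl
      map_smul' := fun r f => by rw [F.map_smul]; rfl }
  have hφ (y : C) : Function.Bijective (φ y) :=
    (Function.bijective_iff_existsUnique _).2 (he y)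
  exact ⟨NatIso.ofComponents (fun y => (LinearEquiv.ofBijective (φ y) (hφ y)).toModuleIso)
    fun {y z} g => by
      ext f
      exact map_comp_hom_apply F f g e⟩

end Corepresentable

/-! ### Exchanging copowers between two linear functors -/

instance : HasFiniteBiproducts (FGModuleCat.{u} k) := HasFiniteBiproducts.of_hasFiniteCoproducts

namespace copower

theorem fg_hom_ext {V U W : FGModuleCat.{u} k} {f g : copower V U ⟶ W}
    (h : ∀ v u, f.hom.hom ((ins V U v).hom.hom u) = g.hom.hom ((ins V U v).hom.hom u)) : f = g :=
  hom_ext fun v => FGModuleCat.hom_ext (LinearMap.ext fun u => h v u)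

/-- The linear map `U → U ⊗ V`, `u ↦ u ⊗ v`, as a linear function of `v`. -/
noncomputable def insRight (V U : FGModuleCat.{u} k) : V →ₗ[k] (U ⟶ copower U V) where
  toFun v := FGModuleCat.ofHom
    { toFun := fun u => (ins U V u).hom.hom v
      map_add' := fun u u' => by rw [map_add]; rfl
      map_smul' := fun r u => by rw [map_smul]; rfl }
  map_add' v v' := FGModuleCat.hom_ext (LinearMap.ext fun u => map_add (ins U V u).hom.hom v v')
  map_smul' r v := FGModuleCat.hom_ext (LinearMap.ext fun u => map_smul (ins U V u).hom.hom r v)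

/-- The symmetry `V ⊗ U ⟶ U ⊗ V` on finite-dimensional vector spaces. -/
noncomputable def swapHom (V U : FGModuleCat.{u} k) : copower V U ⟶ copower U V :=
  desc (insRight V U)

theorem swapHom_apply (V U : FGModuleCat.{u} k) (v : V) (u : U) :
    (swapHom V U).hom.hom ((ins V U v).hom.hom u) = (ins U V u).hom.hom v :=
  congrArg (fun t : U ⟶ copower U V => t.hom.hom u) (ins_desc (insRight V U) v)

theorem swapHom_swapHom (V U : FGModuleCat.{u} k) : swapHom V U ≫ swapHom U V = 𝟙 _ :=
  fg_hom_ext fun v u =>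
    (congrArg (swapHom U V).hom.hom (swapHom_apply V U v u)).trans (swapHom_apply U V u v)

/-- The symmetry of the tensor product of finite-dimensional vector spaces. -/
noncomputable def swap (V U : FGModuleCat.{u} k) : copower V U ≅ copower U V :=
  ⟨swapHom V U, swapHom U V, swapHom_swapHom V U, swapHom_swapHom U V⟩

section Exchange

variable {C D : Type*} [Category.{u} C] [Category.{u} D] [Preadditive C] [Preadditive D]
  [Linear k C] [Linear k D] [HasFiniteBiproducts C] [HasFiniteBiproducts D]

theorem map_ins_ext (F : D ⥤ FGModuleCat.{u} k) [F.Additive] [F.Linear k]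
    {V : FGModuleCat.{u} k} {d : D} {W : FGModuleCat.{u} k} {f g : F.obj (copower V d) ⟶ W}
    (h : ∀ v u, f.hom.hom ((F.map (ins V d v)).hom.hom u) =
      g.hom.hom ((F.map (ins V d v)).hom.hom u)) : f = g := by
  rw [← cancel_epi (comparison F V d).hom]
  refine hom_ext fun v => ?_
  rw [ins_comparison_hom_assoc, ins_comparison_hom_assoc]
  exact FGModuleCat.hom_ext (LinearMap.ext fun u => h v u)

variable (F : D ⥤ FGModuleCat.{u} k) [F.Additive] [F.Linear k]
  (G : C ⥤ FGModuleCat.{u} k) [G.Additive] [G.Linear k]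

/-- Both `F (G c ⊗ d)` and `G (F d ⊗ c)` are identified with `F d ⊗ G c`. -/
noncomputable def exchange (d : D) (c : C) :
    F.obj (copower (G.obj c) d) ≅ G.obj (copower (F.obj d) c) :=
  (comparison F (G.obj c) d).symm ≪≫ swap _ _ ≪≫ comparison G (F.obj d) c

theorem exchange_apply (d : D) (c : C) (v : G.obj c) (u : F.obj d) :
    (exchange F G d c).hom.hom.hom ((F.map (ins (G.obj c) d v)).hom.hom u) =
      (G.map (ins (F.obj d) c u)).hom.hom v := by
  have h1 : F.map (ins (G.obj c) d v) ≫ (comparison F (G.obj c) d).inv =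
      ins (G.obj c) (F.obj d) v := by
    rw [Iso.comp_inv_eq, ins_comparison_hom]
  have h2 := congrArg (fun t => t.hom.hom u) h1
  have h3 := congrArg (fun t => t.hom.hom v) (ins_comparison_hom G (F.obj d) c u)
  change (comparison G (F.obj d) c).hom.hom.hom ((swapHom _ _).hom.hom
    ((comparison F (G.obj c) d).inv.hom.hom ((F.map (ins (G.obj c) d v)).hom.hom u))) = _
  refine Eq.trans ?_ h3
  refine congrArg (comparison G (F.obj d) c).hom.hom.hom ?_
  exact (congrArg (swapHom _ _).hom.hom h2).trans (swapHom_apply _ _ v u)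

variable {F G} {F' : D ⥤ FGModuleCat.{u} k} [F'.Additive] [F'.Linear k]
  {G' : C ⥤ FGModuleCat.{u} k} [G'.Additive] [G'.Linear k]

/-- Naturality of `exchange` in all four variables. -/
theorem exchange_naturality (α : F ⟶ F') (β : G ⟶ G') {d d' : D} (g : d ⟶ d') {c c' : C}
    (h : c ⟶ c') {m : G.obj c ⟶ G'.obj c'} (hm : m = G.map h ≫ β.app c')
    {n : F.obj d ⟶ F'.obj d'} (hn : n = F.map g ≫ α.app d') :
    F.map (copower.map m g) ≫ α.app _ ≫ (exchange F' G' d' c').hom =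
      (exchange F G d c).hom ≫ G.map (copower.map n h) ≫ β.app _ := by
  subst hm hn
  refine map_ins_ext F fun v u => ?_
  have h1 : F.map (ins (G.obj c) d v) ≫ F.map (copower.map (G.map h ≫ β.app c') g) ≫ α.app _ =
      (F.map g ≫ α.app d') ≫ F'.map (ins (G'.obj c') d' ((G.map h ≫ β.app c').hom.hom v)) := by
    rw [← F.map_comp_assoc, ins_map, F.map_comp_assoc, α.naturality, Category.assoc]
  have h2 : G.map (ins (F.obj d) c u) ≫ G.map (copower.map (F.map g ≫ α.app d') h) ≫ β.app _ =
      (G.map h ≫ β.app c') ≫ G'.map (ins (F'.obj d') c' ((F.map g ≫ α.app d').hom.hom u)) := by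
    rw [← G.map_comp_assoc, ins_map, G.map_comp_assoc, β.naturality, Category.assoc]
  have h1' := congrArg (fun t => t.hom.hom u) h1
  have h2' := congrArg (fun t => t.hom.hom v) h2
  refine (congrArg (exchange F' G' d' c').hom.hom.hom h1').trans ?_
  refine (exchange_apply F' G' d' c' _ _).trans ?_
  refine Eq.trans h2'.symm ?_
  exact (congrArg (G.map (copower.map (F.map g ≫ α.app d') h) ≫ β.app _).hom.hom
    (exchange_apply F G d c v u)).symm

end Exchange

end copower

/-! ### The duality pairing and Hom -/

/-- The functor `Hom` with values in finite-dimensional vector spaces. -/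
def homFunctor (C : RexCat.{u} k) (hfin : ∀ x y : C.carrier, Module.Finite k (x ⟶ y)) :
    C.carrierᵒᵖ ⥤ C.carrier ⥤ (vect k).carrier where
  obj x := (ModuleCat.isFG k).lift ((linearCoyoneda k C.carrier).obj x) fun y => hfin x.unop y
  map f :=
    { app := fun y => ObjectProperty.homMk (((linearCoyoneda k C.carrier).map f).app y)
      naturality := fun y z g =>
        ObjectProperty.hom_ext _ (((linearCoyoneda k C.carrier).map f).naturality g) }
  map_id x := by
    ext y
    exact ObjectProperty.hom_ext _
      (congrArg (fun t => t.app y) ((linearCoyoneda k C.carrier).map_id x))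
  map_comp f g := by
    ext y
    exact ObjectProperty.hom_ext _
      (congrArg (fun t => t.app y) ((linearCoyoneda k C.carrier).map_comp f g))

theorem homFunctor_isRex {C : RexCat.{u} k} (hC : IsRegular C.carrier)
    (hfin : ∀ x y : C.carrier, Module.Finite k (x ⟶ y)) (x : C.carrierᵒᵖ) :
    IsRex k ((homFunctor C hfin).obj x) := by
  let F := (linearCoyoneda k C.carrier).obj x
  have hadd : ((homFunctor C hfin).obj x).Additive :=
    ⟨fun {_ _ f g} => ObjectProperty.hom_ext _ (F.map_add (f := f) (g := g))⟩
  exact ⟨hadd, ⟨fun f r => ObjectProperty.hom_ext _ (ModuleCat.hom_ext (LinearMap.ext fun h =>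
    Linear.comp_smul _ _ _ h r f))⟩, hC.preservesFiniteColimits _⟩

/-- Every 1-morphism from a finite semisimple category to `Vect` is corepresentable. -/
theorem exists_homFunctor_iso {C : RexCat.{u} k} (hC : IsRegular C.carrier)
    (hfin : ∀ x y : C.carrier, Module.Finite k (x ⟶ y)) {ι : Type} [Fintype ι]
    {c : ι → C.carrier} (hc : IsGenerating c) (F : C.carrier ⥤ (vect k).carrier)
    (hF : IsRex k F) : ∃ x, Nonempty ((homFunctor C hfin).obj x ≅ F) := by
  let F' : C.carrier ⥤ ModuleCat.{u} k := F ⋙ vectInclusion k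
  have := hF.additive
  have := hF.linear
  have : (vectInclusion k).Additive := ⟨rfl⟩
  have : (vectInclusion k).Linear k := ⟨fun _ _ => rfl⟩
  have : F'.Additive := inferInstanceAs (F ⋙ vectInclusion k).Additive
  have : F'.Linear k := inferInstanceAs ((F ⋙ vectInclusion k).Linear k)
  obtain ⟨x, e, he⟩ := hC.exists_universal_element F'
    (fun x => have := hfin x x; hC.isArtinianObject (k := k) x)
    (exists_generator F' (fun y => (F.obj y).property) hc)
  obtain ⟨i⟩ := nonempty_linearCoyoneda_iso F' e he
  exact ⟨Opposite.op x, ⟨NatIso.ofComponents (fun y => ObjectProperty.isoMk _ (i.app y))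
    fun g => ObjectProperty.hom_ext _ (i.hom.naturality g)⟩⟩

namespace DualityData

variable {C : RexCat.{u} k} (d : DualityData C)

/-- An object `ξ` of the dual is recovered from the functor `⟨ξ | -⟩`, by the second zigzag
identity. -/
theorem vectPairing_faithful : d.vectPairing.Faithful where
  map_injective {ξ ξ'} f g hfg := by
    obtain ⟨T, hT, ⟨e⟩, ⟨z⟩⟩ := d.exists_rightAction
    have h : T.map f = T.map g := by
      refine d.tensorDual.natTrans_ext (hT.right ξ) (hT.right ξ') fun c η => ?_
      let E (ξ : d.dual.carrier) : (T.obj ξ).obj ((d.tensorDual.tmul.obj c).obj η) ≅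
          ((act d.dual).obj ((d.vectPairing.obj ξ).obj c)).obj η := ((e.app ξ).app c).app η
      have hn (f : ξ ⟶ ξ') : (T.map f).app ((d.tensorDual.tmul.obj c).obj η) =
          ((E ξ).hom ≫ ((act d.dual).map ((d.vectPairing.map f).app c)).app η) ≫ (E ξ').inv :=
        (Iso.eq_comp_inv _).2 (congrArg (fun t => (t.app c).app η) (e.hom.naturality f))
      rw [hn f, hn g, hfg]
    have := Functor.Faithful.of_iso z.symm
    exact (T.flip.obj d.copairing).map_injective (congrArg (fun t => t.app d.copairing) h)

section

variable (hC : IsRegular C.carrier) (hfin : ∀ x y : C.carrier, Module.Finite k (x ⟶ y))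

/-- The functor sending `x` to the bifunctor `(c, η) ↦ Hom (x, c) ⊗ η`. -/
noncomputable def homAct : C.carrierᵒᵖ ⥤ Birex C d.dual d.dual :=
  ObjectProperty.lift _ (homFunctor C hfin ⋙ (Functor.whiskeringRight _ _ _).obj (act d.dual))
    fun x => ⟨fun η => (homFunctor_isRex hC hfin x).comp ((act_isBirex d.dual).left η),
      fun c => (act_isBirex d.dual).right (((homFunctor C hfin).obj x).obj c)⟩

/-- The functor sending `x` to the 1-morphism `Hom (x, -) ⊠ 1 : C ⊠ C^∨ ⟶ C^∨`. -/
noncomputable def homTensor : C.carrierᵒᵖ ⥤ Rex d.tensorDual.obj d.dual :=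
  have := d.tensorDual.universal d.dual
  d.homAct hC hfin ⋙ (restrict d.tensorDual.tmul d.tensorDual.isBirex d.dual).inv

/-- The defining property of `homTensor`. -/
noncomputable def homTensorIso : d.homTensor hC hfin ⋙
    restrict d.tensorDual.tmul d.tensorDual.isBirex d.dual ≅ d.homAct hC hfin :=
  have := d.tensorDual.universal d.dual
  Functor.isoWhiskerLeft (d.homAct hC hfin)
    (restrict d.tensorDual.tmul d.tensorDual.isBirex d.dual).asEquivalence.counitIso

/-- The functor `x ↦ ξ_x`: the image of the copairing under `Hom (x, -) ⊠ 1`. -/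
noncomputable def homDual : C.carrierᵒᵖ ⥤ d.dual.carrier :=
  d.homTensor hC hfin ⋙ ObjectProperty.ι _ ⋙ (evaluation _ _).obj d.copairing

end

/-- The isomorphism `⟨Hom (x, c) ⊗ η | y⟩ ≅ Hom (x, ⟨η | y⟩ ⊗ c)`, natural in all variables. -/
theorem nonempty_exchangeIso (hC : IsRegular C.carrier)
    (hfin : ∀ x y : C.carrier, Module.Finite k (x ⟶ y)) :
    Nonempty ((flipFunctor _ _ _ ⋙ (Functor.whiskeringRight _ _ _).obj (flipFunctor _ _ _ ⋙
      (Functor.whiskeringRight _ _ _).obj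
        ((Functor.whiskeringRight _ _ _).obj d.vectPairing ⋙ Functor.uncurry))).obj
          (homFunctor C hfin ⋙ (Functor.whiskeringRight _ _ _).obj (act d.dual)) ≅
    ((Functor.whiskeringRight _ _ _).obj ((Functor.whiskeringRight _ _ _).obj
      (Functor.whiskeringLeft _ _ _ ⋙ (Functor.whiskeringLeft _ _ _).obj (homFunctor C hfin) ⋙
        Functor.uncurry))).obj (bifunctorComp₂₃ (act C).flip d.vectPairing)) := by
  let P (y : C.carrier) : d.dual.carrier ⥤ FGModuleCat.{u} k := d.vectPairing.flip.obj y
  let H (x : C.carrierᵒᵖ) : C.carrier ⥤ FGModuleCat.{u} k := (homFunctor C hfin).obj x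
  have (y : C.carrier) : (P y).Additive := (d.vectPairing_isBirex.left y).additive
  have (y : C.carrier) : (P y).Linear k := (d.vectPairing_isBirex.left y).linear
  have (x : C.carrierᵒᵖ) : (H x).Additive := (homFunctor_isRex hC hfin x).additive
  have (x : C.carrierᵒᵖ) : (H x).Linear k := (homFunctor_isRex hC hfin x).linear
  refine ⟨NatIso.ofComponents (fun c => NatIso.ofComponents (fun η => NatIso.ofComponents
    (fun p => copower.exchange (P p.2) (H p.1) η c) ?_) ?_) ?_⟩
  · intro p q f
    let α : P p.2 ⟶ P q.2 := d.vectPairing.flip.map f.2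
    let β : H p.1 ⟶ H q.1 := (homFunctor C hfin).map f.1
    have h := copower.exchange_naturality α β (𝟙 η) (𝟙 c) (m := β.app c) (n := α.app η)
      (by simp) (by simp)
    exact (Category.assoc _ _ _).trans (h.trans (_ ≫= β.naturality _))
  · intro η η' g
    ext p : 2
    have h := copower.exchange_naturality (𝟙 (P p.2)) (𝟙 (H p.1)) g (𝟙 c)
      (m := 𝟙 ((H p.1).obj c)) (n := (P p.2).map g) (by simp) (by simp)
    simp only [NatTrans.id_app, Category.id_comp, Category.comp_id] at h
    exact h
  · intro c c' g
    ext η p : 4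
    have h := copower.exchange_naturality (𝟙 (P p.2)) (𝟙 (H p.1)) (𝟙 η) g
      (m := (H p.1).map g) (n := 𝟙 ((P p.2).obj η)) (by simp) (by simp)
    simp only [NatTrans.id_app, Category.id_comp, Category.comp_id] at h
    exact h

/-- `⟨ξ_x | y⟩ ≅ Hom (x, y)`: both are values at the copairing of right exact functors on
`C ⊠ C^∨`, namely `W ↦ ⟨(Hom (x, -) ⊠ 1) W | y⟩` and `W ↦ Hom (x, W ⋆ y)`, which agree on pure
tensors; and the copairing acts as the identity by the first zigzag identity. -/
theorem nonempty_homDual_vectPairing_iso (hC : IsRegular C.carrier)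
    (hfin : ∀ x y : C.carrier, Module.Finite k (x ⟶ y)) :
    Nonempty (d.homDual hC hfin ⋙ d.vectPairing ≅ homFunctor C hfin) := by
  obtain ⟨T, hT, ⟨e⟩, ⟨z⟩⟩ := d.exists_leftAction
  obtain ⟨ex⟩ := d.nonempty_exchangeIso hC hfin
  let L : C.carrierᵒᵖ ⥤ d.tensorDual.obj.carrier ⥤ d.dual.carrier :=
    d.homTensor hC hfin ⋙ ObjectProperty.ι _
  let G₁ : d.tensorDual.obj.carrier ⥤ C.carrierᵒᵖ × C.carrier ⥤ (vect k).carrier :=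
    L.flip ⋙ (Functor.whiskeringRight _ _ _).obj d.vectPairing ⋙ Functor.uncurry
  let J : (C.carrier ⥤ C.carrier) ⥤ (C.carrierᵒᵖ × C.carrier ⥤ (vect k).carrier) :=
    Functor.whiskeringLeft _ _ _ ⋙ (Functor.whiskeringLeft _ _ _).obj (homFunctor C hfin) ⋙
      Functor.uncurry
  let G₂ := T ⋙ J
  have i₁ : bifunctorComp₁₂ d.tensorDual.tmul G₁ ≅ _ :=
    (flipFunctor _ _ _ ⋙ (Functor.whiskeringRight _ _ _).obj (flipFunctor _ _ _ ⋙
      (Functor.whiskeringRight _ _ _).obj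
        ((Functor.whiskeringRight _ _ _).obj d.vectPairing ⋙ Functor.uncurry))).mapIso
      (Functor.isoWhiskerRight (d.homTensorIso hC hfin) (ObjectProperty.ι _))
  have i₂ : bifunctorComp₁₂ d.tensorDual.tmul G₂ ≅ _ :=
    ((Functor.whiskeringRight _ _ _).obj ((Functor.whiskeringRight _ _ _).obj J)).mapIso e
  obtain ⟨i⟩ := d.tensorDual.nonempty_iso_param (X := vect k) (F := G₁) (G := G₂)
    (fun p => ((d.homTensor hC hfin).obj p.1).property.comp (d.vectPairing_isBirex.left p.2))
    (fun p => (hT.left p.2).comp (homFunctor_isRex hC hfin p.1))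
    (i₁ ≪≫ ex ≪≫ i₂.symm)
  have j : Functor.uncurry.obj (d.homDual hC hfin ⋙ d.vectPairing) ≅
      Functor.uncurry.obj (homFunctor C hfin) :=
    i.app d.copairing ≪≫ J.mapIso z
  exact ⟨Functor.currying.fullyFaithfulFunctor.preimageIso j⟩

/-- Every object `ξ` of the dual is `ξ_x` for the object `x` which corepresents `⟨ξ | -⟩`. -/
theorem homDual_essSurj (hC : IsRegular C.carrier)
    (hfin : ∀ x y : C.carrier, Module.Finite k (x ⟶ y)) {ι : Type} [Fintype ι]
    {c : ι → C.carrier} (hc : IsGenerating c) : (d.homDual hC hfin).EssSurj where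
  mem_essImage ξ := by
    obtain ⟨T, hT, ⟨e⟩, ⟨z⟩⟩ := d.exists_rightAction
    obtain ⟨x, ⟨i⟩⟩ := exists_homFunctor_iso hC hfin hc (d.vectPairing.obj ξ)
      (d.vectPairing_isBirex.right ξ)
    have j : postcomp d.tensorDual.tmul ((d.homTensor hC hfin).obj x).obj ≅
        postcomp d.tensorDual.tmul (T.obj ξ) :=
      (ObjectProperty.ι _).mapIso ((d.homTensorIso hC hfin).app x) ≪≫
        (Functor.isoWhiskerRight i (act d.dual) :) ≪≫ (e.app ξ).symm
    obtain ⟨l⟩ := d.tensorDual.nonempty_iso ((d.homTensor hC hfin).obj x).property (hT.right ξ) j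
    exact ⟨x, ⟨l.app d.copairing ≪≫ z.app ξ⟩⟩

end DualityData

end RexCat

theorem mainTheorem4 {k : Type u} [Field k] (C : RexCat.{u} k) (hC : RexCat.IsTwoDualizable C) :
    RexCat.IsFiniteSemisimpleAbelian k C.carrier ∧
    ∀ d : RexCat.DualityData C, ∃ e : C.carrierᵒᵖ ≌ d.dual.carrier,
      e.functor.Additive ∧
      (∀ (r : k) {x y : C.carrier} (f : x ⟶ y),
        e.functor.map (r • f).op = r • e.functor.map f.op) ∧
      Nonempty (e.functor ⋙ d.pairing ≅ linearCoyoneda k C.carrier) := by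
  -- A right adjoint of the copairing makes `𝟭 C` a summand of a finite sum of functors which
  -- factor through `Vect`.
  obtain ⟨d₀, -, hcoev, -⟩ := hC
  obtain ⟨f⟩ := d₀.nonempty_vectFactorization hcoev
  refine ⟨f.isFiniteSemisimpleAbelian, fun d => ?_⟩
  let Φ := d.homDual f.isRegular f.finite_hom
  obtain ⟨i⟩ := d.nonempty_homDual_vectPairing_iso f.isRegular f.finite_hom
  have j : Φ ⋙ d.pairing ≅ linearCoyoneda k C.carrier :=
    Functor.isoWhiskerRight i ((Functor.whiskeringRight _ _ _).obj (RexCat.vectInclusion k))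
  -- The pairing is faithful, so equations between values of `Φ` may be checked on `⟨Φ - | z⟩`,
  -- where `hj` computes them as composition in `C`.
  have hj {x y : C.carrierᵒᵖ} (f : x ⟶ y) (z : C.carrier) :
      (d.pairing.map (Φ.map f)).app z = ((j.app x).app z).hom ≫
        ((linearCoyoneda k C.carrier).map f).app z ≫ ((j.app y).app z).inv :=
    ((Iso.eq_comp_inv _).2 (congrArg (fun t => t.app z) (j.hom.naturality f))).trans
      (Category.assoc _ _ _)
  have hfaith : d.pairing.Faithful := ⟨fun {ξ ξ' a b} hab =>
    d.vectPairing_faithful.map_injective (by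
      ext y
      exact ObjectProperty.hom_ext _ (congrArg (fun t => t.app y) hab))⟩
  have : Φ.Faithful := Functor.Faithful.of_comp_iso j
  have : Φ.Full := Functor.Full.of_comp_faithful_iso j
  have : Φ.EssSurj := d.homDual_essSurj f.isRegular f.finite_hom f.isGenerating
  have : Φ.IsEquivalence := { }
  refine ⟨Φ.asEquivalence, ?_, ?_, ⟨j⟩⟩
  · refine ⟨fun {x y f g} => hfaith.map_injective ?_⟩
    ext z : 2
    have := (d.vectPairing_isBirex.left z).additive
    refine (hj (f + g) z).trans ?_
    have h1 : ((linearCoyoneda k C.carrier).map (f + g)).app z =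
        ((linearCoyoneda k C.carrier).map f).app z + ((linearCoyoneda k C.carrier).map g).app z :=
      ModuleCat.hom_ext (LinearMap.ext fun h => Preadditive.add_comp _ _ _ f.unop g.unop h)
    rw [h1, Preadditive.add_comp, Preadditive.comp_add, ← hj, ← hj]
    exact (congrArg (RexCat.vectInclusion k).map
      ((d.vectPairing.flip.obj z).map_add (f := Φ.map f) (g := Φ.map g))).symm
  · refine fun r {x y} f => hfaith.map_injective ?_
    ext z : 2
    have := (d.vectPairing_isBirex.left z).linear
    refine (hj (r • f).op z).trans ?_
    have h1 : ((linearCoyoneda k C.carrier).map (r • f).op).app z =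
        r • ((linearCoyoneda k C.carrier).map f.op).app z :=
      ModuleCat.hom_ext (LinearMap.ext fun h => Linear.smul_comp _ _ _ r f h)
    rw [h1, Linear.smul_comp, Linear.comp_smul, ← hj]
    exact (congrArg (RexCat.vectInclusion k).map
      ((d.vectPairing.flip.obj z).map_smul r (Φ.map f.op))).symm
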